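/- All logarithms are in base $2$. For an abelian group $G$ and real $x\ge 1$ let $\beta_G(x)=\max\{|H| : H\le G \text{ a finite subgroup},\ |H|\le x\}$, and write $\binom{n}{\le m}=\sum_{k=0}^{m}\binom{n}{k}$. **Theorem 1.7.** Let $n,m\ge 1$ be integers with $m\le n/16$, let $G$ be an abelian group and let $Y\subseteq G$ be a set with $|Y|=n$. Then the number of pairs $(A,B)$ of nonempty subsets of $Y$ with $|A+B|\le m$ is at most $$n^{6\sqrt m}\binom{n}{\le m}.$$ Furthermore, put $\alpha=\left(\frac{\sqrt m}{\log n}\right)^{1/2}$ and $\beta=\beta_G\!\left(m+\alpha^{-2/3}m\right)$, and let $s\ge\sqrt m$ be an integer. Then the number of pairs $(A,B)$ of subsets of $Y$ with $|A+B|\le m$ and $|A|,|B|\ge s$ is at most $$n^{(4+6\alpha)\sqrt m}\ \text{ if } m\le(\log n)^2,\qquad\text{and at most}\qquad 2^{(1+2^{13}\alpha^{-2/3})(m+\beta)}\ \text{ if } m>(\log n)^2 .$$ -/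

import Mathlib

open scoped Pointwise

/-- `maxSubgroupSize G x` is `β_G(x)`, the largest size of a finite subgroup of `G` having at most
`x` elements.  The set below is bounded by `x`, and for `x ≥ 1` it contains `1`
(trivial subgroup), so the supremum is a maximum. -/
noncomputable def maxSubgroupSize (G : Type*) [AddCommGroup G] (x : ℝ) : ℕ :=
  sSup {k : ℕ | ∃ H : AddSubgroup G, Finite H ∧ Nat.card H = k ∧ (k : ℝ) ≤ x}

/-- The pairs `(A, B)` of subsets of `Y` with `|A + B| ≤ m`. -/
def sumsetPairs {G : Type*} [AddCommGroup G] [DecidableEq G] (Y : Finset G) (m : ℕ) :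
    Finset (Finset G × Finset G) :=
  (Y.powerset ×ˢ Y.powerset).filter fun p => (p.1 + p.2).card ≤ m

/-- The pairs `(A, B)` of nonempty subsets of `Y` with `|A + B| ≤ m`. -/
def nonemptySumsetPairs {G : Type*} [AddCommGroup G] [DecidableEq G] (Y : Finset G) (m : ℕ) :
    Finset (Finset G × Finset G) :=
  (sumsetPairs Y m).filter fun p => p.1.Nonempty ∧ p.2.Nonempty

/-- The pairs `(A, B)` of subsets of `Y` with `|A + B| ≤ m` and `|A|, |B| ≥ s`. -/
def largeSumsetPairs {G : Type*} [AddCommGroup G] [DecidableEq G] (Y : Finset G) (m s : ℕ) :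
    Finset (Finset G × Finset G) :=
  (sumsetPairs Y m).filter fun p => s ≤ p.1.card ∧ s ≤ p.2.card

/-- `α = (√m / log n)^{1/2}`, with the logarithm in base 2. -/
noncomputable def alphaParam (n m : ℕ) : ℝ :=
  (Real.sqrt m / Real.logb 2 n) ^ (1 / 2 : ℝ)

/-! Count pairs by containers. Fix `k = ⌈√m⌉` and subsets `A₀ ⊆ A`, `B₀ ⊆ B` of size `k`. Translates
`a + B₀` with at least `(1 - δ)k` new sums can be added to `A₀ + B₀` only about `√m / (1 - δ)` times
before `m` is exceeded. Afterwards every element of `A` has more than `δk` of its sums with `B₀` in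
the set already revealed, and at most `m/δ` elements of `Y` have this property. The same holds for
`B`, so `n^(2√m + 2 + 2(√m - 1)/(1 - δ))` pairs of containers of size at most `m/δ` suffice
(`exists_sqrt_container_family`).

With `δ = 1/2` the subsets of the containers number at most `16^m ≤ n.choose m`; pairs with a set
smaller than `√m` are counted directly. This is the first bound. For `m ≤ (log n)^2` the choice `δ =
α` (or `1/2` when `α` is large) balances the two costs.

For `m > (log n)^2` put `ε = α^(-2/3)`, so that `√m * log n = ε^3 * m`. Containers of size `(1 +
ε)m` are refined in rounds (`card_pairs_le_of_terminal`). Let `C` be the part of `A + B` revealed so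
far. If `k` elements of `A` each have at least `ε^2 m / 2` sums with the container of `B` outside
`C`, revealing them together with a few elements of `B` shrinks that container or enlarges `C` by a
total of at least `ε^2 m / 4`. Hence there are `O(ε^(-2))` rounds, at total cost `2^(O(εm))`. At
termination almost all sums of the two containers lie in a set of size `m`, and the Pollard-Kneser
inequality `pollard_kneser` bounds the total container size by `m + β + O(εm)` (`card_add_card_le`).
-/

/-- The number of ways to write `x = u + v` with `u ∈ U` and `v ∈ V`. -/
def sumReps {G : Type*} [AddCommGroup G] [DecidableEq G] (U V : Finset G) (x : G) : ℕ :=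
  (V.filter fun v => x - v ∈ U).card

/-! ### Pollard's inequality with a subgroup defect, by Dyson transforms. -/

section Pollard

variable {G : Type*} [AddCommGroup G] [DecidableEq G]

lemma sumReps_le_card (U V : Finset G) (x : G) : sumReps U V x ≤ V.card :=
  Finset.card_filter_le _ _

lemma sum_sumReps {U V Z : Finset G} (h : U + V ⊆ Z) :
    ∑ x ∈ Z, sumReps U V x = U.card * V.card := by
  unfold sumReps
  simp_rw [Finset.card_filter]
  rw [Finset.sum_comm]
  have : ∀ v ∈ V, ∑ x ∈ Z, (if x - v ∈ U then 1 else 0) = U.card := by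
    intro v hv
    rw [← Finset.card_filter]
    apply Finset.card_nbij' (fun x => x - v) (fun u => u + v)
    · intro x hx
      simpa using (Finset.mem_filter.1 hx).2
    · intro u hu
      simp only [Finset.coe_filter, Set.mem_ofPred_eq, add_sub_cancel_right]
      exact ⟨h (Finset.add_mem_add hu hv), hu⟩
    · intro x _; simp
    · intro x _; simp
  rw [Finset.sum_congr rfl this]
  simp [mul_comm]

/-- Representation counts split along the Dyson transform. -/
lemma sumReps_dyson (U V : Finset G) (e x : G) :
    sumReps U V x =
      sumReps (U ∪ V.image (· + e)) (V.filter fun v => v + e ∈ U) x +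
      sumReps (U \ (V.filter fun v => v + e ∈ U).image (· + e))
        (V.filter fun v => ¬ (v + e ∈ U)) x := by
  set I := V.filter fun v => v + e ∈ U with hI
  set J := V.filter fun v => ¬ (v + e ∈ U) with hJ
  have h1 : sumReps U V x = sumReps U I x + sumReps U J x := by
    unfold sumReps
    rw [hI, hJ, Finset.filter_filter, Finset.filter_filter,
      ← Finset.card_filter_add_card_filter_not (s := V.filter fun v => x - v ∈ U)
        (fun v => v + e ∈ U), Finset.filter_filter, Finset.filter_filter]
    simp_rw [and_comm]
  have h2 : sumReps (U ∪ V.image (· + e)) I x = sumReps U I x +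
      (I.filter fun i => x - i - e ∈ J).card := by
    unfold sumReps
    rw [← Finset.card_union_of_disjoint]
    · congr 1
      ext i
      simp only [Finset.mem_filter, Finset.mem_union, Finset.mem_image, hJ]
      constructor
      · rintro ⟨hi, h | ⟨v, hv, hve⟩⟩
        · exact Or.inl ⟨hi, h⟩
        · by_cases hU : x - i ∈ U
          · exact Or.inl ⟨hi, hU⟩
          · refine Or.inr ⟨hi, ?_, ?_⟩
            · rw [← hve]; simpa using hv
            · simpa using hU
      · rintro (⟨hi, h⟩ | ⟨hi, h, h'⟩)
        · exact ⟨hi, Or.inl h⟩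
        · exact ⟨hi, Or.inr ⟨_, h, by simp⟩⟩
    · rw [Finset.disjoint_left]
      intro i hi hi'
      simp only [Finset.mem_filter, hJ] at hi hi'
      exact hi'.2.2 (by simpa using hi.2)
  have h3 : sumReps U J x = sumReps (U \ I.image (· + e)) J x +
      (J.filter fun j => x - j - e ∈ I).card := by
    unfold sumReps
    rw [← Finset.card_union_of_disjoint]
    · congr 1
      ext j
      simp only [Finset.mem_filter, Finset.mem_union, Finset.mem_sdiff, Finset.mem_image]
      constructor
      · rintro ⟨hj, h⟩
        by_cases hh : x - j - e ∈ I
        · exact Or.inr ⟨hj, hh⟩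
        · refine Or.inl ⟨hj, h, ?_⟩
          rintro ⟨a, ha, hae⟩
          exact hh (by rw [← hae]; simpa using ha)
      · rintro (⟨hj, h, -⟩ | ⟨hj, h⟩)
        · exact ⟨hj, h⟩
        · exact ⟨hj, by simpa using (Finset.mem_filter.1 h).2⟩
    · rw [Finset.disjoint_left]
      intro j hj hj'
      simp only [Finset.mem_filter, Finset.mem_sdiff, Finset.mem_image] at hj hj'
      exact hj.2.2 ⟨_, hj'.2, by simp⟩
  -- The involution `y ↦ x - y - e` matches the representations gained when `U` grows against `I`
  -- with those lost when `U` shrinks against `J`.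
  have h4 : (J.filter fun j => x - j - e ∈ I).card = (I.filter fun i => x - i - e ∈ J).card := by
    apply Finset.card_nbij' (fun j => x - j - e) (fun i => x - i - e)
    · intro j hj
      have := Finset.mem_filter.1 hj
      simp only [Finset.coe_filter, Set.mem_ofPred_eq]
      exact ⟨this.2, by convert this.1 using 1; abel⟩
    · intro j hj
      have := Finset.mem_filter.1 hj
      simp only [Finset.coe_filter, Set.mem_ofPred_eq]
      exact ⟨this.2, by convert this.1 using 1; abel⟩
    · intro j _; dsimp only; abel
    · intro j _; dsimp only; abel
  omega

/-- The terminal case of the Dyson transform: `U` is a union of cosets of a finite subgroup one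
coset of which contains `V`. -/
lemma exists_subgroup_of_periodic {U V : Finset G} (hU : U.Nonempty) (hV : V.Nonempty)
    (h : ∀ u ∈ U, ∀ v ∈ V, ∀ w ∈ V, w + (u - v) ∈ U) :
    ∃ H : AddSubgroup G, Finite H ∧ Nat.card H ≤ U.card ∧ V.card ≤ Nat.card H := by
  obtain ⟨u₀, hu₀⟩ := hU
  obtain ⟨v₀, hv₀⟩ := hV
  let H : AddSubgroup G := AddAction.stabilizer G (U : Set G)
  have hH : ∀ {g : G}, (∀ u ∈ U, g + u ∈ U) → g ∈ H := by
    intro g hg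
    have hsub : U.image (g + ·) ⊆ U := by
      intro y hy
      obtain ⟨u, hu, rfl⟩ := Finset.mem_image.1 hy
      exact hg u hu
    have heq : U.image (g + ·) = U := Finset.eq_of_subset_of_card_le hsub
      (by rw [Finset.card_image_of_injective _ (add_right_injective g)])
    rw [AddAction.mem_stabilizer_iff]
    conv_rhs => rw [← heq]
    simp only [Finset.coe_image]
    rfl
  have hHU : ∀ g ∈ H, g + u₀ ∈ U := by
    intro g hg
    have := AddAction.mem_stabilizer_iff.1 hg
    have h2 : g +ᵥ u₀ ∈ g +ᵥ (U : Set G) := Set.vadd_mem_vadd_set (by simpa using hu₀)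
    rw [this] at h2
    simpa using h2
  let f : H → U := fun g => ⟨g + u₀, hHU g g.2⟩
  have hf : Function.Injective f := by
    intro a b hab
    have := congrArg Subtype.val hab
    exact Subtype.ext (add_right_cancel this)
  have : Finite H := Finite.of_injective f hf
  refine ⟨H, inferInstance, ?_, ?_⟩
  · have := Nat.card_le_card_of_injective f hf
    simpa using this
  · let g : V → H := fun w => ⟨w - v₀, hH fun u hu => by
      convert h u hu v₀ hv₀ w w.2 using 1; abel⟩
    have hg : Function.Injective g := by
      intro a b hab
      have := congrArg Subtype.val hab
      exact Subtype.ext (sub_left_injective this)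
    have := Nat.card_le_card_of_injective g hg
    simpa using this

/-- A Kneser-type extension of Pollard's theorem to arbitrary abelian groups. -/
theorem pollard_kneser {Z : Finset G} : ∀ (N : ℕ) (U V : Finset G) (t : ℕ), V.card ≤ N →
    1 ≤ t → t ≤ U.card → t ≤ V.card → U + V ⊆ Z →
    ∃ H : AddSubgroup G, Finite H ∧
      (t : ℤ) * (U.card + V.card - t - Nat.card H) ≤ ∑ x ∈ Z, min t (sumReps U V x) ∧
      ((t : ℤ) * (U.card + V.card - t) ≤ ∑ x ∈ Z, min t (sumReps U V x) ∨
        (t : ℤ) * Nat.card H ≤ ∑ x ∈ Z, min t (sumReps U V x)) := by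
  intro N
  induction N with
  | zero => intro U V t h1 h2 h3 h4; omega
  | succ N ih =>
  intro U V t hVN ht htU htV hZ
  have hUne : U.Nonempty := Finset.card_pos.1 (by omega)
  have hVne : V.Nonempty := Finset.card_pos.1 (by omega)
  -- If every `V`-difference translates `U` into itself, a subgroup is present; otherwise some shift
  -- `e` splits `V` into two nonempty parts `I` and `J`, and induction on the size of `V` applies.
  by_cases hper : ∀ u ∈ U, ∀ v ∈ V, ∀ w ∈ V, w + (u - v) ∈ U
  · obtain ⟨H, hHf, hHU, hVH⟩ := exists_subgroup_of_periodic hUne hVne hper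
    obtain ⟨v₀, hv₀⟩ := hVne
    have key : t * U.card ≤ ∑ x ∈ Z, min t (sumReps U V x) := by
      calc t * U.card = ∑ x ∈ U.image (· + v₀), t := by
            rw [Finset.sum_const, Finset.card_image_of_injective _ (add_left_injective v₀),
              smul_eq_mul, mul_comm]
        _ ≤ ∑ x ∈ U.image (· + v₀), min t (sumReps U V x) := by
            apply Finset.sum_le_sum
            intro x hx
            obtain ⟨u, hu, rfl⟩ := Finset.mem_image.1 hx
            have : sumReps U V (u + v₀) = V.card := by
              unfold sumReps
              congr 1
              apply Finset.filter_true_of_mem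
              intro v hv
              convert hper u hu v hv v₀ hv₀ using 1; abel
            rw [this]; exact le_min le_rfl htV
        _ ≤ _ := by
            apply Finset.sum_le_sum_of_subset
            intro x hx
            obtain ⟨u, hu, rfl⟩ := Finset.mem_image.1 hx
            exact hZ (Finset.add_mem_add hu hv₀)
    have key' : (t : ℤ) * U.card ≤ ∑ x ∈ Z, min t (sumReps U V x) := by exact_mod_cast key
    refine ⟨H, hHf, le_trans ?_ key', Or.inr (le_trans ?_ key')⟩
    · apply mul_le_mul_of_nonneg_left _ (by positivity)
      have : (V.card : ℤ) ≤ Nat.card H := by exact_mod_cast hVH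
      linarith [Int.natCast_nonneg t]
    · apply mul_le_mul_of_nonneg_left _ (by positivity)
      exact_mod_cast hHU
  · push Not at hper
    obtain ⟨u, hu, v, hv, w, hw, hwU⟩ := hper
    set e := u - v with he
    have hrep := sumReps_dyson U V e
    set I := V.filter fun v => v + e ∈ U with hI
    set J := V.filter fun v => ¬ (v + e ∈ U) with hJ
    set U₁ := U ∪ V.image (· + e) with hU₁
    set U₂ := U \ I.image (· + e) with hU₂
    have hIV : I ⊆ V := Finset.filter_subset _ _
    have hvI : v ∈ I := by simp [hI, hv, he, hu]
    have hwJ : w ∈ J := by simp [hJ, hw, hwU]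
    have hIpos : 1 ≤ I.card := Finset.card_pos.2 ⟨v, hvI⟩
    have hJpos : 1 ≤ J.card := Finset.card_pos.2 ⟨w, hwJ⟩
    have hIJ : I.card + J.card = V.card := Finset.card_filter_add_card_filter_not _
    have hIU : I.image (· + e) ⊆ U := by
      intro y hy
      obtain ⟨i, hi, rfl⟩ := Finset.mem_image.1 hy
      exact (Finset.mem_filter.1 hi).2
    have hIc : (I.image (· + e)).card = I.card :=
      Finset.card_image_of_injective _ (add_left_injective e)
    have hU₂c : U₂.card + I.card = U.card := by
      rw [hU₂, ← hIc]; exact Finset.card_sdiff_add_card_eq_card hIU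
    have hU₁c : U₁.card + I.card = U.card + V.card := by
      have h1 := Finset.card_union_add_card_inter U (V.image (· + e))
      rw [Finset.card_image_of_injective _ (add_left_injective e)] at h1
      have h2 : U ∩ V.image (· + e) = I.image (· + e) := by
        ext y
        simp only [Finset.mem_inter, Finset.mem_image, hI, Finset.mem_filter]
        constructor
        · rintro ⟨hy, a, ha, rfl⟩; exact ⟨a, ⟨ha, hy⟩, rfl⟩
        · rintro ⟨a, ⟨ha, hy⟩, rfl⟩; exact ⟨hy, a, ha, rfl⟩
      rw [h2, hIc] at h1
      exact h1
    have hZ₁ : U₁ + I ⊆ Z := by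
      intro y hy
      obtain ⟨a, ha, i, hi, rfl⟩ := Finset.mem_add.1 hy
      rcases Finset.mem_union.1 ha with ha | ha
      · exact hZ (Finset.add_mem_add ha (hIV hi))
      · obtain ⟨b, hb, rfl⟩ := Finset.mem_image.1 ha
        have := hZ (Finset.add_mem_add (Finset.mem_filter.1 hi).2 hb)
        convert this using 1; abel
    -- If `I` is large enough, `(U₁, I)` has the same total size and takes over. Otherwise all
    -- representations from `(U₁, I)` count in full, at most `|I|` per element, and `(U₂, J)`
    -- supplies the remaining `t - |I|` layers.
    by_cases hti : t ≤ I.card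
    · obtain ⟨H, hHf, h1, h2⟩ := ih U₁ I t (by omega) ht (by omega) hti hZ₁
      have hmono : (∑ x ∈ Z, ((min t (sumReps U₁ I x) : ℕ) : ℤ)) ≤
          ∑ x ∈ Z, ((min t (sumReps U V x) : ℕ) : ℤ) := by
        apply Finset.sum_le_sum
        intro x _
        have := hrep x
        exact_mod_cast min_le_min le_rfl (by omega)
      have hS : (U₁.card : ℤ) + I.card = U.card + V.card := by exact_mod_cast hU₁c
      rw [hS] at h1 h2
      push_cast at h1 h2 hmono ⊢
      exact ⟨H, hHf, h1.trans hmono, h2.imp (fun h => h.trans hmono) (fun h => h.trans hmono)⟩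
    · push Not at hti
      obtain ⟨H, hHf, h1, h2⟩ := ih U₂ J (t - I.card) (by omega) (by omega) (by omega) (by omega)
        (by
          refine le_trans (Finset.add_subset_add ?_ ?_) hZ
          · exact Finset.sdiff_subset
          · exact Finset.filter_subset _ _)
      have hsum : U₁.card * I.card + ∑ x ∈ Z, min (t - I.card) (sumReps U₂ J x) ≤
          ∑ x ∈ Z, min t (sumReps U V x) := by
        rw [← sum_sumReps hZ₁, ← Finset.sum_add_distrib]
        apply Finset.sum_le_sum
        intro x _
        have := hrep x
        have := sumReps_le_card U₁ I x
        omega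
      have hsum' : (U₁.card : ℤ) * I.card +
          (∑ x ∈ Z, ((min (t - I.card) (sumReps U₂ J x) : ℕ) : ℤ)) ≤
          ∑ x ∈ Z, ((min t (sumReps U V x) : ℕ) : ℤ) := by exact_mod_cast hsum
      have e1 : (U₁.card : ℤ) = U.card + V.card - I.card := by
        rw [eq_sub_iff_add_eq]; exact_mod_cast hU₁c
      have e2 : (U₂.card : ℤ) = U.card - I.card := by
        rw [eq_sub_iff_add_eq]; exact_mod_cast hU₂c
      have e3 : (J.card : ℤ) = V.card - I.card := by
        rw [eq_sub_iff_add_eq]; rw [← hIJ]; push_cast; ring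
      have e4 : ((t - I.card : ℕ) : ℤ) = t - I.card := by
        push_cast [hti.le]; ring
      have htU' : (t : ℤ) ≤ U.card := by exact_mod_cast htU
      have htV' : (t : ℤ) ≤ V.card := by exact_mod_cast htV
      have hti' : (I.card : ℤ) < t := by exact_mod_cast hti
      have hI0 : (0 : ℤ) ≤ I.card := by positivity
      have hh0 : (0 : ℤ) ≤ Nat.card H := by positivity
      simp only [Nat.cast_sum] at hsum' h1 h2 ⊢
      rw [e1] at hsum'
      rw [e2, e3, e4] at h1 h2
      push_cast at hsum' h1 h2 ⊢
      refine ⟨H, hHf, ?_, ?_⟩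
      · nlinarith
      · rcases h2 with h2 | h2
        · left; nlinarith
        -- A small `H` satisfies the subgroup bound even on the `|I|` layers filled by `U₁`; a
        -- larger one makes the sum exceed the bound without defect.
        · by_cases hh : (Nat.card H : ℤ) ≤ U.card + V.card - I.card
          · right
            have a1 := mul_le_mul_of_nonneg_left hh hI0
            linarith
          · left
            push Not at hh
            have a1 := mul_le_mul_of_nonneg_left hh.le (sub_nonneg.2 hti'.le)
            have a2 := mul_le_mul_of_nonneg_left hti'.le (Int.natCast_nonneg t)
            linarith

end Pollard

/-! ### Greedy fingerprints and containers. -/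

lemma exists_tuple_between {α : Type*} [DecidableEq α] {A E : Finset α} (hA : A.Nonempty)
    (hEA : E ⊆ A) {t : ℕ} (ht : E.card ≤ t) :
    ∃ e : Fin t → α, (∀ i, e i ∈ A) ∧ E ⊆ Finset.univ.image e := by
  obtain ⟨a, ha⟩ := hA
  refine ⟨fun i => if h : i.1 < E.card then (E.equivFin.symm ⟨i.1, h⟩ : α) else a, ?_, ?_⟩
  · intro i
    dsimp only
    split_ifs with h
    · exact hEA (E.equivFin.symm ⟨i.1, h⟩).2
    · exact ha
  · intro x hx
    rw [Finset.mem_image]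
    refine ⟨⟨E.equivFin ⟨x, hx⟩, (E.equivFin ⟨x, hx⟩).2.trans_le ht⟩, Finset.mem_univ _, ?_⟩
    simp

section Containers

variable {G : Type*} [AddCommGroup G] [DecidableEq G]

/-- A few translates of `F` by elements of `B`, together with `C`, nearly absorb every `b + F`. -/
lemma exists_greedy_translates (C F B : Finset G) {τ : ℝ} (hτ : 0 < τ) :
    ∃ E ⊆ B, (C.card : ℝ) + τ * E.card ≤ (C ∪ (E + F)).card ∧
      ∀ b ∈ B, ((F.filter fun f => b + f ∉ C ∪ (E + F)).card : ℝ) < τ := by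
  -- Take a largest `E` whose every element pays for `τ` new sums on average; a `b` violating the
  -- conclusion could be added to it.
  obtain ⟨E, hE, hmax⟩ := Finset.exists_max_image
    (B.powerset.filter fun E => (C.card : ℝ) + τ * E.card ≤ (C ∪ (E + F)).card)
    Finset.card ⟨∅, by simp⟩
  obtain ⟨hEB, hEc⟩ := Finset.mem_filter.1 hE
  rw [Finset.mem_powerset] at hEB
  refine ⟨E, hEB, hEc, fun b hb => ?_⟩
  by_contra! hcon
  have hbE : b ∉ E := by
    intro hbE
    have : (F.filter fun f => b + f ∉ C ∪ (E + F)) = ∅ := by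
      apply Finset.filter_false_of_mem
      intro f hf
      simp only [not_not]
      exact Finset.mem_union_right _ (Finset.add_mem_add hbE hf)
    rw [this] at hcon
    simp at hcon
    linarith
  have hcard : (C ∪ (E + F)).card + (F.filter fun f => b + f ∉ C ∪ (E + F)).card ≤
      (C ∪ (insert b E + F)).card := by
    rw [← Finset.card_image_of_injective (F.filter fun f => b + f ∉ C ∪ (E + F))
      (add_right_injective b), ← Finset.card_union_of_disjoint]
    · apply Finset.card_le_card
      apply Finset.union_subset
      · exact Finset.union_subset_union le_rfl
          (Finset.add_subset_add_right (Finset.subset_insert _ _))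
      · intro y hy
        obtain ⟨f, hf, rfl⟩ := Finset.mem_image.1 hy
        exact Finset.mem_union_right _
          (Finset.add_mem_add (Finset.mem_insert_self _ _) (Finset.mem_filter.1 hf).1)
    · rw [Finset.disjoint_left]
      intro y hy hy'
      obtain ⟨f, hf, rfl⟩ := Finset.mem_image.1 hy'
      exact (Finset.mem_filter.1 hf).2 hy
  have hcard' : ((C ∪ (E + F)).card : ℝ) + (F.filter fun f => b + f ∉ C ∪ (E + F)).card ≤
      (C ∪ (insert b E + F)).card := by exact_mod_cast hcard
  have hins := Finset.card_insert_of_notMem hbE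
  have := hmax (insert b E) (by
    rw [Finset.mem_filter, Finset.mem_powerset]
    refine ⟨Finset.insert_subset hb hEB, ?_⟩
    rw [hins]; push_cast; linarith)
  omega

/-- The elements `x ∈ Y` most of whose sums with `B` lie in `A + B`. -/
noncomputable def sumContainer (Y : Finset G) (r : ℝ) (A B : Finset G) : Finset G :=
  Y.filter fun x => r < ((B.filter fun b => x + b ∈ A + B).card : ℝ)

/-- Double counting of the pairs `(x, b)` with `x + b ∈ A + B`: each `b` occurs at most `|A + B|`
times, each container element more than `δ|B|` times. -/
lemma card_sumContainer_mul_le (Y A B : Finset G) {δ : ℝ} (hB : B.Nonempty) :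
    ((sumContainer Y (δ * B.card) A B).card : ℝ) * δ ≤ (A + B).card := by
  set X := sumContainer Y (δ * B.card) A B with hX
  have h1 : ∑ x ∈ X, (B.filter fun b => x + b ∈ A + B).card ≤ B.card * (A + B).card := by
    have := Finset.sum_card_bipartiteAbove_eq_sum_card_bipartiteBelow (s := X) (t := B)
      (fun x b => x + b ∈ A + B)
    unfold Finset.bipartiteAbove Finset.bipartiteBelow at this
    rw [this, ← smul_eq_mul]
    apply Finset.sum_le_card_nsmul
    intro b _
    apply Finset.card_le_card_of_injOn (fun x => x + b)
    · intro x hx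
      exact (Finset.mem_filter.1 hx).2
    · exact (add_left_injective b).injOn
  have h2 : (X.card : ℝ) * (δ * B.card) ≤
      ∑ x ∈ X, ((B.filter fun b => x + b ∈ A + B).card : ℝ) := by
    rw [← nsmul_eq_mul]
    apply Finset.card_nsmul_le_sum
    intro x hx
    exact (Finset.mem_filter.1 hx).2.le
  have h3 : (∑ x ∈ X, ((B.filter fun b => x + b ∈ A + B).card : ℝ)) ≤
      B.card * (A + B).card := by exact_mod_cast h1
  have hB' : (0 : ℝ) < B.card := by exact_mod_cast hB.card_pos
  nlinarith

/-- The greedy translates of `B₀` start from `A₀ + B₀`, which already has `k` elements, so `ht`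
forbids more than `t` of them. The tuple may repeat entries, which fixes its length for counting. -/
lemma exists_tuple_subset_sumContainer {Y A B A₀ B₀ : Finset G} {m k t : ℕ} {δ : ℝ}
    (hδ : δ < 1) (hk : 1 ≤ k) (ht : (m : ℝ) - k < (t + 1) * ((1 - δ) * k))
    (hA : A ⊆ Y) (hA₀ : A₀ ⊆ A) (hB₀ : B₀ ⊆ B) (hkA : A₀.card = k) (hkB : B₀.card = k)
    (hAB : (A + B).card ≤ m) :
    ∃ e : Fin t → G, (∀ i, e i ∈ A) ∧
      A ⊆ sumContainer Y (δ * k) (A₀ ∪ Finset.univ.image e) B₀ := by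
  have hk' : (0 : ℝ) < k := by exact_mod_cast hk
  have hτ : 0 < (1 - δ) * (k : ℝ) := mul_pos (by linarith) hk'
  obtain ⟨E, hEA, hEc, hE⟩ := exists_greedy_translates (A₀ + B₀) B₀ A hτ
  have hAne : A₀.Nonempty := Finset.card_pos.1 (by omega)
  have hBne : B₀.Nonempty := Finset.card_pos.1 (by omega)
  have h1 : (k : ℝ) ≤ (A₀ + B₀).card := by
    rw [← hkA]; exact_mod_cast Finset.card_le_card_add_right hBne
  have h2 : (((A₀ + B₀) ∪ (E + B₀)).card : ℝ) ≤ m := by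
    have : ((A₀ + B₀) ∪ (E + B₀)).card ≤ (A + B).card := by
      apply Finset.card_le_card
      exact Finset.union_subset (Finset.add_subset_add hA₀ hB₀) (Finset.add_subset_add hEA hB₀)
    exact_mod_cast this.trans hAB
  have h3 : E.card ≤ t := by
    have : (E.card : ℝ) < t + 1 := by
      by_contra! h
      nlinarith
    have : E.card < t + 1 := by exact_mod_cast this
    omega
  obtain ⟨e, heA, hEe⟩ := exists_tuple_between (hAne.mono hA₀) hEA h3
  refine ⟨e, heA, fun a ha => ?_⟩
  rw [sumContainer, Finset.mem_filter]
  refine ⟨hA ha, ?_⟩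
  have h4 := hE a ha
  have h5 := Finset.card_filter_add_card_filter_not (s := B₀)
    (fun b => a + b ∈ (A₀ + B₀) ∪ (E + B₀))
  have h5' : ((B₀.filter fun b => a + b ∈ (A₀ + B₀) ∪ (E + B₀)).card : ℝ) +
      (B₀.filter fun b => a + b ∉ (A₀ + B₀) ∪ (E + B₀)).card = k := by
    rw [← hkB]; exact_mod_cast h5
  have h6 : ((B₀.filter fun b => a + b ∈ (A₀ + B₀) ∪ (E + B₀)).card : ℝ) ≤
      (B₀.filter fun b => a + b ∈ (A₀ ∪ Finset.univ.image e) + B₀).card := by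
    norm_cast
    apply Finset.card_le_card
    apply Finset.monotone_filter_right
    intro b hb
    have hsub : (A₀ + B₀) ∪ (E + B₀) ⊆ (A₀ ∪ Finset.univ.image e) + B₀ := by
      rw [Finset.union_add]
      exact Finset.union_subset_union le_rfl (Finset.add_subset_add_right hEe)
    exact fun h => hsub h
  linarith

/-- Containers for pairs of sets with small sumset, from fingerprints of `k + t` elements on
either side. -/
theorem exists_container_family (Y : Finset G) {m k t : ℕ} {δ : ℝ} (hδ : δ < 1)
    (hk : 1 ≤ k) (ht : (m : ℝ) - k < (t + 1) * ((1 - δ) * k)) :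
    ∃ 𝓕 : Finset (Finset G × Finset G), 𝓕.card ≤ Y.card ^ (2 * (k + t)) ∧
      (∀ X ∈ 𝓕, (X.1 ⊆ Y ∧ X.2 ⊆ Y) ∧ (X.1.card : ℝ) * δ ≤ m ∧ (X.2.card : ℝ) * δ ≤ m) ∧
      ∀ A B : Finset G, A ⊆ Y → B ⊆ Y → k ≤ A.card → k ≤ B.card → (A + B).card ≤ m →
        ∃ X ∈ 𝓕, A ⊆ X.1 ∧ B ⊆ X.2 := by
  let D : Finset (Finset G × (Fin t → G)) :=
    Y.powersetCard k ×ˢ Fintype.piFinset fun _ => Y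
  let ext : Finset G × (Fin t → G) → Finset G := fun d => d.1 ∪ Finset.univ.image d.2
  let Φ : (Finset G × (Fin t → G)) × (Finset G × (Fin t → G)) → Finset G × Finset G :=
    fun p => (sumContainer Y (δ * k) (ext p.1) p.2.1, sumContainer Y (δ * k) (ext p.2) p.1.1)
  refine ⟨((D ×ˢ D).image Φ).filter fun X =>
    (X.1.card : ℝ) * δ ≤ m ∧ (X.2.card : ℝ) * δ ≤ m, ?_, ?_, ?_⟩
  · have hD : D.card ≤ Y.card ^ (k + t) := by
      rw [Finset.card_product, Finset.card_powersetCard, Fintype.card_piFinset, pow_add]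
      simp only [Finset.prod_const, Finset.card_univ, Fintype.card_fin]
      exact Nat.mul_le_mul_right _ (Nat.choose_le_pow _ _)
    calc _ ≤ ((D ×ˢ D).image Φ).card := Finset.card_filter_le _ _
      _ ≤ (D ×ˢ D).card := Finset.card_image_le
      _ = D.card * D.card := Finset.card_product _ _
      _ ≤ Y.card ^ (k + t) * Y.card ^ (k + t) := Nat.mul_le_mul hD hD
      _ = _ := by rw [← pow_add]; congr 1; ring
  · intro X hX
    obtain ⟨hX, hX'⟩ := Finset.mem_filter.1 hX
    obtain ⟨p, -, rfl⟩ := Finset.mem_image.1 hX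
    exact ⟨⟨Finset.filter_subset _ _, Finset.filter_subset _ _⟩, hX'⟩
  · intro A B hA hB hkA hkB hAB
    obtain ⟨A₀, hA₀, hA₀k⟩ := Finset.exists_subset_card_eq hkA
    obtain ⟨B₀, hB₀, hB₀k⟩ := Finset.exists_subset_card_eq hkB
    obtain ⟨e, heA, he⟩ := exists_tuple_subset_sumContainer hδ hk ht hA hA₀ hB₀ hA₀k hB₀k hAB
    obtain ⟨e', heB, he'⟩ := exists_tuple_subset_sumContainer hδ hk ht hB hB₀ hA₀ hB₀k hA₀k
      (by rwa [add_comm])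
    refine ⟨Φ ((A₀, e), (B₀, e')), ?_, he, he'⟩
    have hsize : ∀ {A B A₀ B₀ : Finset G} {e : Fin t → G}, A₀ ⊆ A → B₀ ⊆ B → B₀.card = k →
        (∀ i, e i ∈ A) → (A + B).card ≤ m →
        ((sumContainer Y (δ * k) (A₀ ∪ Finset.univ.image e) B₀).card : ℝ) * δ ≤ m := by
      intro A B A₀ B₀ e hA₀ hB₀ hB₀k heA hAB
      have h1 := card_sumContainer_mul_le Y (A₀ ∪ Finset.univ.image e) B₀ (δ := δ)
        (Finset.card_pos.1 (by omega))
      rw [hB₀k] at h1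
      refine h1.trans ?_
      have : ((A₀ ∪ Finset.univ.image e) + B₀).card ≤ (A + B).card := by
        apply Finset.card_le_card
        apply Finset.add_subset_add _ hB₀
        apply Finset.union_subset hA₀
        intro y hy
        obtain ⟨i, -, rfl⟩ := Finset.mem_image.1 hy
        exact heA i
      exact_mod_cast this.trans hAB
    rw [Finset.mem_filter]
    refine ⟨Finset.mem_image_of_mem _ ?_, hsize hA₀ hB₀ hB₀k heA hAB,
      hsize hB₀ hA₀ hA₀k heB (by rwa [add_comm])⟩
    simp only [D, Finset.mem_product, Finset.mem_powersetCard, Fintype.mem_piFinset]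
    exact ⟨⟨⟨hA₀.trans hA, hA₀k⟩, fun i => hA (heA i)⟩, ⟨hB₀.trans hB, hB₀k⟩,
      fun i => hB (heB i)⟩

/-- `exists_container_family` for `k = ⌈√m⌉`. -/
theorem exists_sqrt_container_family (Y : Finset G) {m : ℕ} {δ : ℝ} (hδ : δ < 1) (hm : 1 ≤ m)
    (hY : 1 ≤ Y.card) :
    ∃ 𝓕 : Finset (Finset G × Finset G),
      (𝓕.card : ℝ) ≤ (Y.card : ℝ) ^ (2 * √m + 2 + 2 * (√m - 1) / (1 - δ)) ∧
      (∀ X ∈ 𝓕, (X.1 ⊆ Y ∧ X.2 ⊆ Y) ∧ (X.1.card : ℝ) * δ ≤ m ∧ (X.2.card : ℝ) * δ ≤ m) ∧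
      ∀ A B : Finset G, A ⊆ Y → B ⊆ Y → ⌈√m⌉₊ ≤ A.card → ⌈√m⌉₊ ≤ B.card →
        (A + B).card ≤ m → ∃ X ∈ 𝓕, A ⊆ X.1 ∧ B ⊆ X.2 := by
  set k := ⌈√(m : ℝ)⌉₊ with hk
  have hm' : (1 : ℝ) ≤ m := by exact_mod_cast hm
  have hsq : √(m : ℝ) * √m = m := Real.mul_self_sqrt (by positivity)
  have hs1 : 1 ≤ √(m : ℝ) := Real.one_le_sqrt.2 hm'
  have hsk : √(m : ℝ) ≤ k := Nat.le_ceil _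
  have hks : (k : ℝ) ≤ √m + 1 := (Nat.ceil_lt_add_one (by positivity)).le
  have hk0 : (0 : ℝ) < k := by linarith
  have hkm : (k : ℝ) ≤ m := by
    have : k ≤ m := Nat.ceil_le.2 (by nlinarith)
    exact_mod_cast this
  have hδ' : 0 < 1 - δ := by linarith
  have hd : 0 < (1 - δ) * k := mul_pos hδ' hk0
  -- The least length that `exists_container_family` allows; `k ≥ √m` gives `(m - k)/k ≤ √m - 1`.
  set t := ⌊((m : ℝ) - k) / ((1 - δ) * k)⌋₊ with ht
  have ht1 : (m : ℝ) - k < (t + 1) * ((1 - δ) * k) := by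
    rw [← div_lt_iff₀ hd]; exact Nat.lt_floor_add_one _
  have ht2 : (t : ℝ) ≤ (√m - 1) / (1 - δ) := by
    refine (Nat.floor_le (div_nonneg (by linarith) hd.le)).trans ?_
    rw [div_le_div_iff₀ hd hδ']
    have : (m : ℝ) - k ≤ (√m - 1) * k := by nlinarith
    nlinarith
  obtain ⟨𝓕, h1, h2, h3⟩ := exists_container_family Y hδ
    (by exact_mod_cast hs1.trans hsk) ht1
  refine ⟨𝓕, ?_, h2, h3⟩
  calc (𝓕.card : ℝ) ≤ (Y.card : ℝ) ^ (2 * (k + t)) := by exact_mod_cast h1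
    _ = (Y.card : ℝ) ^ ((2 * (k + t) : ℕ) : ℝ) := (Real.rpow_natCast _ _).symm
    _ ≤ _ := by
      apply Real.rpow_le_rpow_of_exponent_le (by exact_mod_cast hY)
      push_cast
      rw [mul_div_assoc]
      linarith

lemma card_le_card_mul_of_cover {α : Type*} [DecidableEq α] {P 𝓕 : Finset (Finset α × Finset α)}
    {M : ℝ} (hcov : ∀ p ∈ P, ∃ X ∈ 𝓕, p.1 ⊆ X.1 ∧ p.2 ⊆ X.2)
    (hM : ∀ X ∈ 𝓕, ((P.filter fun p => p.1 ⊆ X.1 ∧ p.2 ⊆ X.2).card : ℝ) ≤ M) :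
    (P.card : ℝ) ≤ 𝓕.card * M := by
  have h1 : P ⊆ 𝓕.biUnion fun X => P.filter fun p => p.1 ⊆ X.1 ∧ p.2 ⊆ X.2 := by
    intro p hp
    obtain ⟨X, hX, h⟩ := hcov p hp
    exact Finset.mem_biUnion.2 ⟨X, hX, Finset.mem_filter.2 ⟨hp, h⟩⟩
  have h2 := (Finset.card_le_card h1).trans Finset.card_biUnion_le
  calc (P.card : ℝ) ≤ ∑ X ∈ 𝓕, ((P.filter fun p => p.1 ⊆ X.1 ∧ p.2 ⊆ X.2).card : ℝ) := by
        exact_mod_cast h2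
    _ ≤ ∑ _X ∈ 𝓕, M := Finset.sum_le_sum hM
    _ = _ := by simp

lemma card_filter_subset_le {α : Type*} [DecidableEq α] (P : Finset (Finset α × Finset α))
    (X₁ X₂ : Finset α) :
    (P.filter fun p => p.1 ⊆ X₁ ∧ p.2 ⊆ X₂).card ≤ 2 ^ (X₁.card + X₂.card) := by
  rw [pow_add, ← Finset.card_powerset, ← Finset.card_powerset, ← Finset.card_product]
  apply Finset.card_le_card
  intro p hp
  simpa using (Finset.mem_filter.1 hp).2

/-- Pairs with small sumset and both sets of size at least `√m`, counted by containers. -/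
theorem card_pairs_le {Y : Finset G} {m : ℕ} {δ : ℝ} (hδ₀ : 0 < δ) (hδ : δ < 1) (hm : 1 ≤ m)
    (hY : 1 ≤ Y.card) {P : Finset (Finset G × Finset G)}
    (hP : ∀ p ∈ P, p.1 ⊆ Y ∧ p.2 ⊆ Y ∧ ⌈√m⌉₊ ≤ p.1.card ∧ ⌈√m⌉₊ ≤ p.2.card ∧
      (p.1 + p.2).card ≤ m) :
    (P.card : ℝ) ≤ (Y.card : ℝ) ^ (2 * √m + 2 + 2 * (√m - 1) / (1 - δ)) *
      2 ^ (2 * (m : ℝ) / δ) := by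
  obtain ⟨𝓕, h1, h2, h3⟩ := exists_sqrt_container_family Y hδ hm hY
  have := card_le_card_mul_of_cover (P := P) (𝓕 := 𝓕) (M := 2 ^ (2 * (m : ℝ) / δ))
    (fun p hp => by
      obtain ⟨a, b, c, d, e⟩ := hP p hp
      exact h3 _ _ a b c d e)
    (fun X hX => by
      obtain ⟨-, ha, hb⟩ := h2 X hX
      calc ((P.filter fun p => p.1 ⊆ X.1 ∧ p.2 ⊆ X.2).card : ℝ)
          ≤ (2 : ℝ) ^ (X.1.card + X.2.card) := by exact_mod_cast card_filter_subset_le _ _ _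
        _ = (2 : ℝ) ^ ((X.1.card + X.2.card : ℕ) : ℝ) := (Real.rpow_natCast _ _).symm
        _ ≤ _ := by
          apply Real.rpow_le_rpow_of_exponent_le (by norm_num)
          push_cast
          rw [le_div_iff₀ hδ₀]
          linarith)
  exact this.trans (mul_le_mul_of_nonneg_right h1 (by positivity))

end Containers

/-! ### Counting small subsets. -/

/-- The sum is `(1 + 1/n)^n ≤ e`. It lets a later sum over sets `E` of unknown size cost only a
constant when each term carries a weight `n^(-|E|)`. -/
lemma sum_powerset_inv_card_pow_le {α : Type*} (Y : Finset α) :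
    ∑ E ∈ Y.powerset, ((Y.card : ℝ)⁻¹) ^ E.card ≤ 3 := by
  have h := Finset.sum_pow_mul_eq_add_pow ((Y.card : ℝ)⁻¹) 1 Y
  simp only [one_pow, mul_one] at h
  rw [h]
  rcases Nat.eq_zero_or_pos Y.card with h0 | h0
  · simp [h0]
  · have hpos : (0 : ℝ) < Y.card := by exact_mod_cast h0
    calc ((Y.card : ℝ)⁻¹ + 1) ^ Y.card ≤ (Real.exp ((Y.card : ℝ)⁻¹)) ^ Y.card :=
          pow_le_pow_left₀ (by positivity) (Real.add_one_le_exp _) _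
      _ = Real.exp 1 := by
          rw [← Real.exp_nat_mul, mul_inv_cancel₀ hpos.ne']
      _ ≤ 3 := by linarith [Real.exp_one_lt_d9]

lemma card_powerset_filter_card_le {α : Type*} {Y : Finset α} (hY : 1 ≤ Y.card) (j : ℕ) :
    ((Y.powerset.filter fun E => E.card ≤ j).card : ℝ) ≤ 3 * (Y.card : ℝ) ^ j := by
  have hY1 : (1 : ℝ) ≤ Y.card := by exact_mod_cast hY
  have hY0 : (0 : ℝ) < Y.card := by linarith
  calc ((Y.powerset.filter fun E => E.card ≤ j).card : ℝ)
      = ∑ E ∈ Y.powerset.filter fun E => E.card ≤ j, (1 : ℝ) := by simp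
    _ ≤ ∑ E ∈ Y.powerset.filter fun E => E.card ≤ j,
          (Y.card : ℝ) ^ j * ((Y.card : ℝ)⁻¹) ^ E.card := by
        apply Finset.sum_le_sum
        intro E hE
        rw [inv_pow, ← div_eq_mul_inv, one_le_div (by positivity)]
        exact pow_le_pow_right₀ hY1 (Finset.mem_filter.1 hE).2
    _ ≤ ∑ E ∈ Y.powerset, (Y.card : ℝ) ^ j * ((Y.card : ℝ)⁻¹) ^ E.card :=
        Finset.sum_le_sum_of_subset_of_nonneg (Finset.filter_subset _ _)
          fun _ _ _ => by positivity
    _ = (Y.card : ℝ) ^ j * ∑ E ∈ Y.powerset, ((Y.card : ℝ)⁻¹) ^ E.card := by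
        rw [Finset.mul_sum]
    _ ≤ (Y.card : ℝ) ^ j * 3 :=
        mul_le_mul_of_nonneg_left (sum_powerset_inv_card_pow_le Y) (by positivity)
    _ = _ := mul_comm _ _

lemma card_powerset_filter_card_le_sum_choose {α : Type*} [DecidableEq α] (Y : Finset α) (m : ℕ) :
    (Y.powerset.filter fun E => E.card ≤ m).card ≤
      ∑ k ∈ Finset.range (m + 1), Y.card.choose k := by
  have h : (Y.powerset.filter fun E => E.card ≤ m) ⊆
      (Finset.range (m + 1)).biUnion fun k => Y.powersetCard k := by
    intro E hE
    obtain ⟨h1, h2⟩ := Finset.mem_filter.1 hE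
    exact Finset.mem_biUnion.2 ⟨E.card, Finset.mem_range.2 (by omega),
      Finset.mem_powersetCard.2 ⟨Finset.mem_powerset.1 h1, rfl⟩⟩
  refine (Finset.card_le_card h).trans (Finset.card_biUnion_le.trans ?_)
  simp [Finset.card_powersetCard]

/-- Induction through `(n + 1) * n.choose m = (n + 1).choose (m + 1) * (m + 1)`, each step gaining a
factor at least `c`. -/
lemma pow_le_choose_of_mul_le (c : ℕ) : ∀ m n : ℕ, c * m ≤ n → c ^ m ≤ n.choose m := by
  intro m
  induction m with
  | zero => intro n _; simp
  | succ m ih =>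
    intro n hn
    rcases Nat.eq_zero_or_pos c with rfl | hc
    · simp
    have hn1 : 1 ≤ n := by nlinarith
    obtain ⟨n, rfl⟩ : ∃ n', n = n' + 1 := ⟨n - 1, by omega⟩
    have h1 := ih n (by nlinarith)
    have h2 := Nat.add_one_mul_choose_eq n m
    apply Nat.le_of_mul_le_mul_right _ (Nat.succ_pos m)
    rw [Nat.succ_eq_add_one, ← h2, pow_succ]
    calc c ^ m * c * (m + 1) = (c * (m + 1)) * c ^ m := by ring
      _ ≤ (n + 1) * n.choose m := Nat.mul_le_mul hn h1

/-! ### The bound for all nonempty pairs and the range `m ≤ (log n)^2`. -/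

section Counting

variable {G : Type*} [AddCommGroup G] [DecidableEq G]

lemma mem_sumsetPairs {Y : Finset G} {m : ℕ} {p : Finset G × Finset G} :
    p ∈ sumsetPairs Y m ↔ p.1 ⊆ Y ∧ p.2 ⊆ Y ∧ (p.1 + p.2).card ≤ m := by
  simp [sumsetPairs, and_assoc]

theorem card_nonemptySumsetPairs_le {n m : ℕ} (hm : 1 ≤ m) (hmn : 16 * m ≤ n) {Y : Finset G}
    (hY : Y.card = n) :
    ((nonemptySumsetPairs Y m).card : ℝ) ≤
      (n : ℝ) ^ (6 * √m) * (∑ k ∈ Finset.range (m + 1), (n.choose k : ℝ)) := by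
  set k := ⌈√(m : ℝ)⌉₊ with hk
  set S := ∑ k ∈ Finset.range (m + 1), (n.choose k : ℝ) with hS
  have hm' : (1 : ℝ) ≤ m := by exact_mod_cast hm
  have hn : (16 : ℝ) ≤ n := by
    have : 16 ≤ n := by omega
    exact_mod_cast this
  have hs1 : 1 ≤ √(m : ℝ) := Real.one_le_sqrt.2 hm'
  have hks : (k : ℝ) < √m + 1 := Nat.ceil_lt_add_one (by positivity)
  have hk1 : 1 ≤ k := Nat.ceil_pos.2 (by linarith)
  have hS16 : (2 : ℝ) ^ (2 * (m : ℝ) / (1 / 2)) ≤ S := by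
    have h1 : ((16 ^ m : ℕ) : ℝ) ≤ n.choose m := by
      exact_mod_cast pow_le_choose_of_mul_le 16 m n hmn
    have h2 : (n.choose m : ℝ) ≤ S :=
      Finset.single_le_sum (f := fun k => (n.choose k : ℝ)) (fun _ _ => by positivity)
        (Finset.self_mem_range_succ m)
    have h3 : (2 : ℝ) ^ (2 * (m : ℝ) / (1 / 2)) = ((16 ^ m : ℕ) : ℝ) := by
      rw [show 2 * (m : ℝ) / (1 / 2) = 4 * m by ring, Real.rpow_mul (by norm_num),
        Real.rpow_natCast]
      norm_num
    linarith
  have hS0 : 0 ≤ S := le_trans (by positivity) hS16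
  set P := nonemptySumsetPairs Y m with hP
  set small := Y.powerset.filter fun E => E.card ≤ k - 1 with hsmall
  set med := Y.powerset.filter fun E => E.card ≤ m with hmed
  have hsmallc : (small.card : ℝ) ≤ 3 * (n : ℝ) ^ √(m : ℝ) := by
    have h := card_powerset_filter_card_le (Y := Y) (by omega) (k - 1)
    rw [hY] at h
    refine h.trans (mul_le_mul_of_nonneg_left ?_ (by norm_num))
    rw [← Real.rpow_natCast]
    apply Real.rpow_le_rpow_of_exponent_le (by linarith)
    rw [Nat.cast_sub hk1]; push_cast; linarith
  have hmedc : (med.card : ℝ) ≤ S := by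
    have h := card_powerset_filter_card_le_sum_choose Y m
    rw [hY] at h
    rw [hS]
    exact_mod_cast h
  set Q := P.filter fun p => k ≤ p.1.card ∧ k ≤ p.2.card with hQ
  have hQc : (Q.card : ℝ) ≤ (n : ℝ) ^ (6 * √(m : ℝ) - 2) * S := by
    have h := card_pairs_le (Y := Y) (m := m) (δ := 1 / 2) (by norm_num) (by norm_num) hm
      (by omega) (P := Q) (by
        intro p hp
        simp only [hQ, hP, nonemptySumsetPairs, Finset.mem_filter, mem_sumsetPairs] at hp
        tauto)
    rw [hY, show 2 * √(m : ℝ) + 2 + 2 * (√m - 1) / (1 - 1 / 2) = 6 * √m - 2 by ring] at h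
    exact h.trans (mul_le_mul_of_nonneg_left hS16 (by positivity))
  have hsub : P ⊆ (small ×ˢ med ∪ med ×ˢ small) ∪ Q := by
    intro p hp
    have hp' := hp
    simp only [hP, nonemptySumsetPairs, Finset.mem_filter, mem_sumsetPairs] at hp'
    obtain ⟨⟨h1, h2, h3⟩, h4, h5⟩ := hp'
    have h6 : p.1.card ≤ m := (Finset.card_le_card_add_right h5).trans h3
    have h7 : p.2.card ≤ m := (Finset.card_le_card_add_left h4).trans h3
    simp only [Finset.mem_union, Finset.mem_product, hsmall, hmed, hQ, Finset.mem_filter,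
      Finset.mem_powerset]
    by_cases h8 : k ≤ p.1.card
    · by_cases h9 : k ≤ p.2.card
      · exact Or.inr ⟨hp, h8, h9⟩
      · exact Or.inl (Or.inr ⟨⟨h1, h6⟩, h2, by omega⟩)
    · exact Or.inl (Or.inl ⟨⟨h1, by omega⟩, h2, h7⟩)
  have hc : P.card ≤ small.card * med.card + med.card * small.card + Q.card := by
    refine (Finset.card_le_card hsub).trans ((Finset.card_union_le _ _).trans ?_)
    gcongr
    refine (Finset.card_union_le _ _).trans ?_
    rw [Finset.card_product, Finset.card_product]
  have hc' : (P.card : ℝ) ≤ small.card * med.card + med.card * small.card + Q.card := by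
    exact_mod_cast hc
  have hprod : (small.card : ℝ) * med.card ≤ 3 * (n : ℝ) ^ √(m : ℝ) * S :=
    mul_le_mul hsmallc hmedc (by positivity) (by positivity)
  have hn0 : (0 : ℝ) < n := by linarith
  have hpow1 : (n : ℝ) ^ (6 * √(m : ℝ)) = n ^ (6 * √(m : ℝ) - 2) * (n : ℝ) ^ 2 := by
    rw [← Real.rpow_natCast (n : ℝ) 2, ← Real.rpow_add hn0]
    congr 1; push_cast; ring
  have hpow2 : (n : ℝ) ^ √(m : ℝ) ≤ n ^ (6 * √(m : ℝ) - 2) :=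
    Real.rpow_le_rpow_of_exponent_le (by linarith) (by linarith)
  have hpos : 0 ≤ (n : ℝ) ^ (6 * √(m : ℝ) - 2) := by positivity
  -- The container exponent for `δ = 1/2` is `6√m - 2`; the spare factor `n^2` absorbs the constant
  -- `7`.
  calc (P.card : ℝ) ≤ 6 * (n : ℝ) ^ √(m : ℝ) * S + (n : ℝ) ^ (6 * √(m : ℝ) - 2) * S := by
        linarith
    _ ≤ (n ^ (6 * √(m : ℝ) - 2) * 7) * S := by nlinarith
    _ ≤ (n : ℝ) ^ (6 * √(m : ℝ)) * S := by
        rw [hpow1]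
        gcongr
        nlinarith

lemma largeSumsetPairs_spec {Y : Finset G} {m s : ℕ} (hs : √(m : ℝ) ≤ s) :
    ∀ p ∈ largeSumsetPairs Y m s, p.1 ⊆ Y ∧ p.2 ⊆ Y ∧ ⌈√(m : ℝ)⌉₊ ≤ p.1.card ∧
      ⌈√(m : ℝ)⌉₊ ≤ p.2.card ∧ (p.1 + p.2).card ≤ m := by
  intro p hp
  simp only [largeSumsetPairs, Finset.mem_filter, mem_sumsetPairs] at hp
  obtain ⟨⟨h1, h2, h3⟩, h4, h5⟩ := hp
  have : ⌈√(m : ℝ)⌉₊ ≤ s := Nat.ceil_le.2 hs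
  exact ⟨h1, h2, this.trans h4, this.trans h5, h3⟩

lemma rpow_eq_two_rpow {x : ℝ} (hx : 0 < x) (y : ℝ) :
    x ^ y = 2 ^ (Real.logb 2 x * y) := by
  rw [Real.rpow_mul (by norm_num), Real.rpow_logb (by norm_num) (by norm_num) hx]

lemma four_le_logb {n m : ℕ} (hm : 1 ≤ m) (hmn : 16 * m ≤ n) : 4 ≤ Real.logb 2 n := by
  have hn : (16 : ℝ) ≤ n := by
    have : 16 ≤ n := by omega
    exact_mod_cast this
  rw [Real.le_logb_iff_rpow_le (by norm_num) (by linarith)]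
  norm_num
  linarith

theorem card_largeSumsetPairs_le_of_le_sq {n m s : ℕ} (hm : 1 ≤ m) (hmn : 16 * m ≤ n)
    {Y : Finset G} (hY : Y.card = n) (hs : √(m : ℝ) ≤ s) (hmL : (m : ℝ) ≤ Real.logb 2 n ^ 2) :
    ((largeSumsetPairs Y m s).card : ℝ) ≤ (n : ℝ) ^ ((4 + 6 * alphaParam n m) * √m) := by
  have hL := four_le_logb hm hmn
  set L := Real.logb 2 n with hLdef
  have hL0 : 0 < L := by linarith
  have hm' : (1 : ℝ) ≤ m := by exact_mod_cast hm
  have hn0 : (0 : ℝ) < n := by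
    have : 0 < n := by omega
    exact_mod_cast this
  have hs1 : 1 ≤ √(m : ℝ) := Real.one_le_sqrt.2 hm'
  have hsq : √(m : ℝ) * √m = m := Real.mul_self_sqrt (by positivity)
  set α := alphaParam n m with hα
  have hα0 : 0 < α := by unfold α alphaParam; positivity
  have hα2 : α ^ 2 * L = √m := by
    rw [hα, alphaParam, ← Real.sqrt_eq_rpow, Real.sq_sqrt (by positivity), div_mul_cancel₀]
    exact hL0.ne'
  have hsL : √(m : ℝ) ≤ L := Real.sqrt_le_iff.2 ⟨hL0.le, hmL⟩
  have hα1 : α ≤ 1 := by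
    by_contra! h
    have : 1 < α ^ 2 := by nlinarith
    nlinarith
  -- Turns the factor `2^(2m/δ)` into a power of `n`, so only exponents of `n` need comparing.
  have hmα : (m : ℝ) = L * (α ^ 2 * √m) := by
    calc (m : ℝ) = √m * √m := hsq.symm
      _ = (α ^ 2 * L) * √m := by rw [hα2]
      _ = _ := by ring
  have main : ∀ δ : ℝ, 0 < δ → δ < 1 →
      2 * √(m : ℝ) + 2 + 2 * (√m - 1) / (1 - δ) + 2 * (α ^ 2 * √m) / δ ≤ (4 + 6 * α) * √m →
      ((largeSumsetPairs Y m s).card : ℝ) ≤ (n : ℝ) ^ ((4 + 6 * α) * √m) := by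
    intro δ h0 h1 hle
    have h := card_pairs_le h0 h1 hm (by omega) (largeSumsetPairs_spec (Y := Y) hs)
    refine h.trans ?_
    rw [hY, rpow_eq_two_rpow hn0, rpow_eq_two_rpow hn0, ← Real.rpow_add (by norm_num)]
    apply Real.rpow_le_rpow_of_exponent_le (by norm_num)
    calc L * (2 * √(m : ℝ) + 2 + 2 * (√m - 1) / (1 - δ)) + 2 * (m : ℝ) / δ
        = L * (2 * √(m : ℝ) + 2 + 2 * (√m - 1) / (1 - δ) + 2 * (α ^ 2 * √m) / δ) := by
          rw [hmα]
          have : √(L * (α ^ 2 * √(m : ℝ))) = √m := by rw [← hmα]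
          rw [this]
          ring
      _ ≤ _ := mul_le_mul_of_nonneg_left hle hL0.le
  by_cases hα' : α ≤ 1 / 2
  · apply main α hα0 (by linarith)
    have h1 : 2 * (√(m : ℝ) - 1) / (1 - α) ≤ 2 * (√m - 1) * (1 + 2 * α) := by
      rw [div_le_iff₀ (by linarith)]
      have : 1 ≤ (1 + 2 * α) * (1 - α) := by nlinarith
      nlinarith
    have h2 : 2 * (α ^ 2 * √(m : ℝ)) / α = 2 * α * √m := by field_simp
    rw [h2]
    nlinarith
  -- The choice `δ = α` fails near `1`; with `δ = 1/2` the needed inequality is `(2α - 1)(1 - α) ≥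
  -- 0`, up to terms of the right sign.
  · push Not at hα'
    apply main (1 / 2) (by norm_num) (by norm_num)
    have : (2 * α - 1) * (1 - α) * √(m : ℝ) ≥ 0 :=
      mul_nonneg (mul_nonneg (by linarith) (by linarith)) (by linarith)
    rw [show 2 * (√(m : ℝ) - 1) / (1 - 1 / 2) = 4 * √m - 4 by ring,
      show 2 * (α ^ 2 * √(m : ℝ)) / (1 / 2) = 4 * (α ^ 2 * √m) by ring]
    linarith

end Counting

/-! ### Iterated refinement of containers. -/

section Rounds

variable {G : Type*} [AddCommGroup G] [DecidableEq G]

/-- The number of `b ∈ X` with `a + b ∉ C`. -/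
def missCount (C X : Finset G) (a : G) : ℕ := (X.filter fun b => a + b ∉ C).card

lemma missCount_le_add (C C' X X' : Finset G) (a : G) :
    missCount C X a ≤ missCount C' X' a + (X \ X').card + (C' \ C).card := by
  have h : (X.filter fun b => a + b ∉ C) ⊆
      ((X'.filter fun b => a + b ∉ C') ∪ (X \ X')) ∪ X.filter fun b => a + b ∈ C' \ C := by
    intro b hb
    obtain ⟨h1, h2⟩ := Finset.mem_filter.1 hb
    simp only [Finset.mem_union, Finset.mem_filter, Finset.mem_sdiff]
    tauto
  refine (Finset.card_le_card h).trans ((Finset.card_union_le _ _).trans ?_)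
  refine add_le_add (Finset.card_union_le _ _) ?_
  apply Finset.card_le_card_of_injOn (fun b => a + b)
  · intro b hb; exact (Finset.mem_filter.1 hb).2
  · exact (add_right_injective a).injOn

lemma sum_missCount_comm (C X F : Finset G) :
    ∑ f ∈ F, missCount C X f = ∑ b ∈ X, (F.filter fun f => b + f ∉ C).card := by
  have := Finset.sum_card_bipartiteAbove_eq_sum_card_bipartiteBelow (s := F) (t := X)
    (fun f b => f + b ∉ C)
  unfold Finset.bipartiteAbove Finset.bipartiteBelow at this
  unfold missCount
  rw [this]
  simp_rw [add_comm]

/-- If every element of `F` misses `C` often but no element of `X'` misses `C'` often together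
with `F`, then `X'` is much smaller than `X` or `C'` much larger than `C`. -/
lemma half_le_drop {C C' X X' F : Finset G} {m k : ℕ} {D : ℝ} (hm : 1 ≤ m) (hk : 1 ≤ k)
    (hD : 0 < D) (hF : F.card = k) (hFD : ∀ f ∈ F, D ≤ missCount C X f) (hX : X.card ≤ 2 * m)
    (hX' : X' ⊆ X) (hC : C ⊆ C')
    (hmiss : ∀ b ∈ X', ((F.filter fun f => b + f ∉ C').card : ℝ) < k * D / (4 * m)) :
    D / 2 ≤ (X.card : ℝ) - X'.card + C'.card - C.card := by
  have hk0 : (0 : ℝ) < k := by exact_mod_cast hk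
  have hm0 : (0 : ℝ) < m := by exact_mod_cast hm
  have h1 : (k : ℝ) * D ≤ ∑ f ∈ F, (missCount C X f : ℝ) := by
    rw [← hF, ← nsmul_eq_mul]
    exact Finset.card_nsmul_le_sum _ _ _ hFD
  have e1 : ((X \ X').card : ℝ) = X.card - X'.card := by
    rw [Finset.card_sdiff_of_subset hX', Nat.cast_sub (Finset.card_le_card hX')]
  have e2 : ((C' \ C).card : ℝ) = C'.card - C.card := by
    rw [Finset.card_sdiff_of_subset hC, Nat.cast_sub (Finset.card_le_card hC)]
  have h2 : ∑ f ∈ F, (missCount C X f : ℝ) ≤ ∑ f ∈ F, (missCount C' X' f : ℝ) +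
      k * (X.card - X'.card + (C'.card - C.card)) := by
    rw [← hF, ← nsmul_eq_mul, ← Finset.sum_const, ← Finset.sum_add_distrib]
    apply Finset.sum_le_sum
    intro f _
    rw [← e1, ← e2]
    have := missCount_le_add C C' X X' f
    rw [← add_assoc]
    exact_mod_cast this
  have h3 : ∑ f ∈ F, (missCount C' X' f : ℝ) ≤ k * (D / 2) := by
    have := sum_missCount_comm C' X' F
    calc ∑ f ∈ F, (missCount C' X' f : ℝ)
        = ∑ b ∈ X', ((F.filter fun f => b + f ∉ C').card : ℝ) := by
          exact_mod_cast this
      _ ≤ X'.card • (k * D / (4 * m)) := Finset.sum_le_card_nsmul _ _ _ fun b hb => (hmiss b hb).le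
      _ ≤ (2 * m) * (k * D / (4 * m)) := by
          rw [nsmul_eq_mul]
          have : (X'.card : ℝ) ≤ 2 * m := by exact_mod_cast (Finset.card_le_card hX').trans hX
          gcongr
      _ = k * (D / 2) := by field_simp; ring
  have h4 : (k : ℝ) * (D / 2) ≤ k * (X.card - X'.card + (C'.card - C.card)) := by linarith
  have := le_of_mul_le_mul_left h4 hk0
  linarith

/-- A first set is recovered from its few elements outside `X₁` and its trace on `X₁`. -/
lemma card_le_of_card_sdiff_le {α : Type*} [DecidableEq α] {Y X₁ X₂ : Finset α}
    (hY : 1 ≤ Y.card) {k : ℕ} {P : Finset (Finset α × Finset α)}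
    (hP : ∀ p ∈ P, p.1 ⊆ Y ∧ p.2 ⊆ X₂ ∧ (p.1 \ X₁).card ≤ k) :
    (P.card : ℝ) ≤ 3 * (Y.card : ℝ) ^ k * 2 ^ (X₁.card + X₂.card) := by
  have h : P.card ≤ ((Y.powerset.filter fun E => E.card ≤ k) ×ˢ
      (X₁.powerset ×ˢ X₂.powerset)).card := by
    apply Finset.card_le_card_of_injOn (fun p => (p.1 \ X₁, p.1 ∩ X₁, p.2))
    · intro p hp
      obtain ⟨h1, h2, h3⟩ := hP p hp
      simp only [Finset.coe_product, Set.mem_prod, Finset.mem_coe, Finset.mem_filter,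
        Finset.mem_powerset]
      exact ⟨⟨Finset.sdiff_subset.trans h1, h3⟩, Finset.inter_subset_right, h2⟩
    · intro p _ q _ hpq
      simp only [Prod.mk.injEq] at hpq
      obtain ⟨h1, h2, h3⟩ := hpq
      ext1
      · rw [← Finset.sdiff_union_inter p.1 X₁, h1, h2, Finset.sdiff_union_inter]
      · exact h3
  rw [Finset.card_product, Finset.card_product, Finset.card_powerset, Finset.card_powerset,
    ← pow_add] at h
  calc (P.card : ℝ) ≤ ((Y.powerset.filter fun E => E.card ≤ k).card : ℝ) *
        2 ^ (X₁.card + X₂.card) := by exact_mod_cast h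
    _ ≤ _ := mul_le_mul_of_nonneg_right (card_powerset_filter_card_le hY k) (by positivity)

set_option maxHeartbeats 1000000 in
/-- Iterated containers: if every pair of containers all of whose elements rarely leave `C` is
small, then there are few pairs with small sumset. -/
theorem card_pairs_le_of_terminal {Y XA XB : Finset G} {m k : ℕ} {D M : ℝ} (hY : 1 ≤ Y.card)
    (hm : 1 ≤ m) (hk : 1 ≤ k) (hD : 0 < D) (hXA : XA ⊆ Y) (hXB : XB ⊆ Y)
    (hXBm : XB.card ≤ 2 * m) (hM : 0 ≤ M)
    (hterm : ∀ X₁ ⊆ XA, ∀ X₂ ⊆ XB, ∀ C : Finset G, C.card ≤ m →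
      (∀ a ∈ X₁, (missCount C X₂ a : ℝ) < D) → (2 : ℝ) ^ (X₁.card + X₂.card) ≤ M) :
    ∀ (j : ℕ) (P : Finset (Finset G × Finset G)) (X C : Finset G), X ⊆ XB →
      (∀ p ∈ P, p.1 ⊆ XA ∧ p.2 ⊆ X ∧ C ⊆ p.1 + p.2 ∧ (p.1 + p.2).card ≤ m) →
      (X.card : ℝ) + m - C.card ≤ j * (D / 2) →
      (P.card : ℝ) ≤ (6 * (Y.card : ℝ) ^ k) ^ (j + 1) *
        (Y.card : ℝ) ^ (((m : ℝ) - C.card) / (k * D / (4 * m))) * M := by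
  have hk0 : (0 : ℝ) < k := by exact_mod_cast hk
  have hm0 : (0 : ℝ) < m := by exact_mod_cast hm
  have hn1 : (1 : ℝ) ≤ Y.card := by exact_mod_cast hY
  have hn0 : (0 : ℝ) < Y.card := by linarith
  set τ := (k : ℝ) * D / (4 * m) with hτ
  have hτ0 : 0 < τ := by positivity
  have hnk : (1 : ℝ) ≤ (Y.card : ℝ) ^ k := one_le_pow₀ hn1
  -- Pairs with fewer than `k` elements of `A` missing `C` often are counted by the terminal
  -- hypothesis; only the others, bounded by `R`, need another round.
  have split : ∀ (P : Finset (Finset G × Finset G)) (X C : Finset G) (R : ℝ), X ⊆ XB →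
      (∀ p ∈ P, p.1 ⊆ XA ∧ p.2 ⊆ X ∧ C ⊆ p.1 + p.2 ∧ (p.1 + p.2).card ≤ m) →
      ((P.filter fun p =>
        k ≤ (p.1 \ XA.filter fun a => (missCount C X a : ℝ) < D).card).card : ℝ) ≤ R →
      P.Nonempty → (P.card : ℝ) ≤ 3 * (Y.card : ℝ) ^ k * M + R := by
    intro P X C R hX hP hR hne
    set X₁ := XA.filter fun a => (missCount C X a : ℝ) < D with hX₁
    obtain ⟨p, hp⟩ := hne
    obtain ⟨-, -, hC1, hC2⟩ := hP p hp
    have hM' := hterm X₁ (Finset.filter_subset _ _) X hX C ((Finset.card_le_card hC1).trans hC2)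
      (fun a ha => (Finset.mem_filter.1 ha).2)
    have h1 := card_le_of_card_sdiff_le (Y := Y) (X₁ := X₁) (X₂ := X) hY (k := k)
      (P := P.filter fun p => ¬ k ≤ (p.1 \ X₁).card) (fun p hp => by
        obtain ⟨h1, h2⟩ := Finset.mem_filter.1 hp
        obtain ⟨h3, h4, -⟩ := hP p h1
        exact ⟨h3.trans hXA, h4, by omega⟩)
    have h2 := Finset.card_filter_add_card_filter_not (s := P) (fun p => k ≤ (p.1 \ X₁).card)
    have h2' : (P.card : ℝ) = (P.filter fun p => k ≤ (p.1 \ X₁).card).card +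
        (P.filter fun p => ¬ k ≤ (p.1 \ X₁).card).card := by exact_mod_cast h2.symm
    have h4 : 3 * (Y.card : ℝ) ^ k * 2 ^ (X₁.card + X.card) ≤ 3 * (Y.card : ℝ) ^ k * M :=
      mul_le_mul_of_nonneg_left hM' (by positivity)
    linarith [hR]
  have hbig : ∀ {p : Finset G × Finset G} {X C : Finset G}, p.1 ⊆ XA →
      ∀ f ∈ p.1 \ XA.filter fun a => (missCount C X a : ℝ) < D, D ≤ missCount C X f := by
    intro p X C hp f hf
    rw [Finset.mem_sdiff, Finset.mem_filter] at hf
    by_contra! h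
    exact hf.2 ⟨hp hf.1, h⟩
  have hone : ∀ {C : Finset G}, C.card ≤ m →
      1 ≤ (Y.card : ℝ) ^ (((m : ℝ) - C.card) / τ) := by
    intro C hC
    have : (C.card : ℝ) ≤ m := by exact_mod_cast hC
    exact Real.one_le_rpow hn1 (div_nonneg (by linarith) hτ0.le)
  intro j
  induction j with
  | zero =>
    intro P X C hX hP hpot
    rcases P.eq_empty_or_nonempty with rfl | hne
    · simp only [Finset.card_empty, Nat.cast_zero]; positivity
    obtain ⟨p₀, hp₀⟩ := hne
    have hCm := (Finset.card_le_card (hP p₀ hp₀).2.2.1).trans (hP p₀ hp₀).2.2.2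
    have hCm' : (C.card : ℝ) ≤ m := by exact_mod_cast hCm
    -- The potential `|X| + m - |C|` is exhausted and `|C| ≤ m`, so `X` is empty and nothing can
    -- miss `C` at least `D > 0` times.
    have h := split P X C 0 hX hP (by
      rw [Finset.filter_false_of_mem]
      · simp
      · intro p hp hkp
        obtain ⟨f, hf⟩ := Finset.card_pos.1 (show 0 < _ from hk.trans hkp)
        have h1 := hbig (hP p hp).1 f hf
        have h2 : (missCount C X f : ℝ) ≤ X.card := by
          exact_mod_cast Finset.card_filter_le _ _
        simp only [Nat.cast_zero, zero_mul] at hpot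
        linarith) ⟨p₀, hp₀⟩
    have h1 := hone hCm
    have h2 : 3 * (Y.card : ℝ) ^ k * M ≤ 6 * (Y.card : ℝ) ^ k * M := by
      have := mul_nonneg (show 0 ≤ (Y.card : ℝ) ^ k by positivity) hM
      nlinarith
    calc (P.card : ℝ) ≤ 6 * (Y.card : ℝ) ^ k * 1 * M := by linarith
      _ ≤ _ := by
        rw [zero_add, pow_one]
        gcongr
  | succ j ih =>
    intro P X C hX hP hpot
    rcases P.eq_empty_or_nonempty with rfl | hne
    · simp only [Finset.card_empty, Nat.cast_zero]; positivity
    obtain ⟨p₀, hp₀⟩ := hne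
    have hCm := (Finset.card_le_card (hP p₀ hp₀).2.2.1).trans (hP p₀ hp₀).2.2.2
    set Z := (6 * (Y.card : ℝ) ^ k) ^ (j + 1) with hZ
    set W := (Y.card : ℝ) ^ (((m : ℝ) - C.card) / τ) with hW
    have hW1 : 1 ≤ W := hone hCm
    have hZ1 : 1 ≤ Z := one_le_pow₀ (by linarith)
    set X₁ := XA.filter fun a => (missCount C X a : ℝ) < D with hX₁
    set R := P.filter fun p => k ≤ (p.1 \ X₁).card with hR
    let X' : Finset G × Finset G → Finset G := fun q =>
      X.filter fun b => ((q.1.filter fun f => b + f ∉ C ∪ (q.2 + q.1)).card : ℝ) < τ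
    -- The pairs with fingerprint `q = (F, E)`: `F` consists of `k` elements missing often, and `E`
    -- is the greedy set that absorbs the translates of `F`.
    let S : Finset G × Finset G → Finset (Finset G × Finset G) := fun q =>
      R.filter fun p => q.1 ⊆ p.1 \ X₁ ∧ q.2 ⊆ p.2 ∧
        (C.card : ℝ) + τ * q.2.card ≤ (C ∪ (q.2 + q.1)).card ∧ p.2 ⊆ X' q
    have hcov : R ⊆ (Y.powersetCard k ×ˢ Y.powerset).biUnion S := by
      intro p hp
      obtain ⟨hpP, hpk⟩ := Finset.mem_filter.1 hp
      obtain ⟨h1, h2, -⟩ := hP p hpP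
      obtain ⟨F, hF, hFk⟩ := Finset.exists_subset_card_eq hpk
      obtain ⟨E, hE, hEc, hEm⟩ := exists_greedy_translates C F p.2 hτ0
      refine Finset.mem_biUnion.2 ⟨(F, E), ?_, ?_⟩
      · rw [Finset.mem_product, Finset.mem_powersetCard, Finset.mem_powerset]
        exact ⟨⟨(hF.trans Finset.sdiff_subset).trans (h1.trans hXA), hFk⟩,
          hE.trans (h2.trans (hX.trans hXB))⟩
      · exact Finset.mem_filter.2 ⟨hp, hF, hE, hEc, fun b hb =>
          Finset.mem_filter.2 ⟨h2 hb, hEm b hb⟩⟩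
    have hS : ∀ q ∈ Y.powersetCard k ×ˢ Y.powerset,
        ((S q).card : ℝ) ≤ Z * W * M * ((Y.card : ℝ)⁻¹) ^ q.2.card := by
      intro q hq
      rw [Finset.mem_product, Finset.mem_powersetCard] at hq
      rcases (S q).eq_empty_or_nonempty with he | ⟨p, hp⟩
      · rw [he]; simp only [Finset.card_empty, Nat.cast_zero]; positivity
      obtain ⟨hpR, h1, h2, h3, h4⟩ := Finset.mem_filter.1 hp
      obtain ⟨hpP, hpk⟩ := Finset.mem_filter.1 hpR
      have hdrop := half_le_drop (C := C) (C' := C ∪ (q.2 + q.1)) (X := X) (X' := X' q)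
        (F := q.1) hm hk hD hq.1.2 (fun f hf => hbig (hP p hpP).1 f (h1 hf))
        ((Finset.card_le_card hX).trans hXBm) (Finset.filter_subset _ _)
        Finset.subset_union_left (fun b hb => (Finset.mem_filter.1 hb).2)
      have hih := ih (S q) (X' q) (C ∪ (q.2 + q.1)) ((Finset.filter_subset _ _).trans hX)
        (fun p hp => by
          obtain ⟨hpR, h1, h2, h3, h4⟩ := Finset.mem_filter.1 hp
          obtain ⟨h5, h6, h7, h8⟩ := hP p (Finset.mem_filter.1 hpR).1
          refine ⟨h5, h4, Finset.union_subset h7 ?_, h8⟩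
          rw [add_comm]
          exact Finset.add_subset_add (h1.trans Finset.sdiff_subset) h2)
        (by push_cast at hpot; linarith)
      refine hih.trans ?_
      -- Each element of `E` enlarges the revealed set by `τ` on average, so the cost of all the `E`
      -- telescopes over the rounds.
      have hpow : (Y.card : ℝ) ^ (((m : ℝ) - (C ∪ (q.2 + q.1)).card) / τ) ≤
          W * ((Y.card : ℝ)⁻¹) ^ q.2.card := by
        rw [hW, inv_pow, ← Real.rpow_natCast, ← Real.rpow_neg hn0.le, ← Real.rpow_add hn0]
        apply Real.rpow_le_rpow_of_exponent_le hn1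
        rw [div_le_iff₀ hτ0, add_mul, div_mul_cancel₀ _ hτ0.ne']
        linarith
      calc _ ≤ Z * (W * ((Y.card : ℝ)⁻¹) ^ q.2.card) * M := by gcongr
        _ = _ := by ring
    have hRc : (R.card : ℝ) ≤ 3 * (Y.card : ℝ) ^ k * (Z * W * M) := by
      have h1 := (Finset.card_le_card hcov).trans Finset.card_biUnion_le
      calc (R.card : ℝ) ≤ ∑ q ∈ Y.powersetCard k ×ˢ Y.powerset, ((S q).card : ℝ) := by
            exact_mod_cast h1
        _ ≤ ∑ q ∈ Y.powersetCard k ×ˢ Y.powerset,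
              Z * W * M * ((Y.card : ℝ)⁻¹) ^ q.2.card := Finset.sum_le_sum hS
        _ = (Y.card.choose k : ℝ) * (Z * W * M *
              ∑ E ∈ Y.powerset, ((Y.card : ℝ)⁻¹) ^ E.card) := by
            rw [Finset.sum_product]
            dsimp only
            rw [← Finset.mul_sum, Finset.sum_const, Finset.card_powersetCard, nsmul_eq_mul]
        _ ≤ (Y.card : ℝ) ^ k * (Z * W * M * 3) := by
            have h2 : (Y.card.choose k : ℝ) ≤ (Y.card : ℝ) ^ k := by
              exact_mod_cast Nat.choose_le_pow _ _
            have h3 := sum_powerset_inv_card_pow_le Y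
            have h4 : 0 ≤ Z * W * M := by positivity
            exact mul_le_mul h2 (mul_le_mul_of_nonneg_left h3 h4)
              (mul_nonneg h4 (Finset.sum_nonneg fun _ _ => by positivity)) (by positivity)
        _ = _ := by ring
    have h := split P X C _ hX hP hRc ⟨p₀, hp₀⟩
    have h5 : M ≤ Z * W * M := by
      have : 1 ≤ Z * W := one_le_mul_of_one_le_of_one_le hZ1 hW1
      nlinarith
    calc (P.card : ℝ) ≤ 3 * (Y.card : ℝ) ^ k * M + 3 * (Y.card : ℝ) ^ k * (Z * W * M) := h
      _ ≤ 3 * (Y.card : ℝ) ^ k * (Z * W * M) + 3 * (Y.card : ℝ) ^ k * (Z * W * M) := by gcongr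
      _ = _ := by rw [pow_succ]; ring

end Rounds

/-! ### Size of terminal containers and the range `m > (log n)^2`. -/

lemma card_le_maxSubgroupSize {G : Type*} [AddCommGroup G] {x : ℝ} (H : AddSubgroup G)
    (hH : Finite H) (hx : (Nat.card H : ℝ) ≤ x) : Nat.card H ≤ maxSubgroupSize G x := by
  apply le_csSup
  · refine ⟨⌊x⌋₊, ?_⟩
    rintro k ⟨-, -, -, hk⟩
    exact Nat.le_floor hk
  · exact ⟨H, hH, rfl, hx⟩

section Terminal

variable {G : Type*} [AddCommGroup G] [DecidableEq G]

/-- Both sides count pairs with sum outside `C`; on the left only the sums in `Z` are seen. -/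
lemma sum_sumReps_sdiff_le (U V Z C : Finset G) :
    ∑ x ∈ Z \ C, sumReps U V x ≤ ∑ a ∈ U, missCount C V a := by
  rw [sum_missCount_comm]
  unfold sumReps
  simp_rw [Finset.card_filter]
  rw [Finset.sum_comm]
  apply Finset.sum_le_sum
  intro v _
  rw [← Finset.card_filter, ← Finset.card_filter]
  apply Finset.card_le_card_of_injOn (fun x => x - v)
  · intro x hx
    simp only [Finset.coe_filter, Finset.mem_sdiff, Set.mem_ofPred_eq] at hx ⊢
    exact ⟨hx.2, by simpa using hx.1.2⟩
  · exact sub_left_injective.injOn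

/-- If almost all sums from `U + V` lie in a set `C` of size at most `m`, then `|U| + |V|` is at
most about `m` plus the size of a subgroup with about `m` elements. -/
theorem card_add_card_le {U V C : Finset G} {m : ℕ} {ε : ℝ} (hε₀ : 0 < ε)
    (hεm : 1 ≤ ε * m) (hU : (U.card : ℝ) ≤ (1 + ε) * m) (hV : (V.card : ℝ) ≤ (1 + ε) * m)
    (hε₁ : ε ≤ 1) (hC : C.card ≤ m) (hmiss : ∀ a ∈ U, (missCount C V a : ℝ) < ε ^ 2 * m / 2) :
    (U.card : ℝ) + V.card ≤ m + maxSubgroupSize G ((m : ℝ) + ε * m) + 4 * (ε * m) := by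
  set β := maxSubgroupSize G ((m : ℝ) + ε * m) with hβ
  have hβ0 : (0 : ℝ) ≤ β := by positivity
  set t := ⌈ε * (m : ℝ)⌉₊ with ht
  have ht1 : ε * m ≤ t := Nat.le_ceil _
  have ht2 : (t : ℝ) ≤ 2 * (ε * m) := by
    have : (t : ℝ) < ε * m + 1 := Nat.ceil_lt_add_one (by linarith)
    linarith
  have ht0 : 1 ≤ t := Nat.ceil_pos.2 (by linarith)
  have ht0' : (0 : ℝ) < t := by linarith
  by_cases htU : t ≤ U.card
  swap
  · have : (U.card : ℝ) < t := by exact_mod_cast not_le.1 htU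
    nlinarith
  by_cases htV : t ≤ V.card
  swap
  · have : (V.card : ℝ) < t := by exact_mod_cast not_le.1 htV
    nlinarith
  obtain ⟨H, hHf, h1, h2⟩ := pollard_kneser V.card U V t le_rfl ht0 htU htV (le_refl (U + V))
  set N := ∑ x ∈ U + V, min t (sumReps U V x) with hN
  have h1' : (t : ℝ) * (U.card + V.card - t - Nat.card H) ≤ N := by exact_mod_cast h1
  have h2' : (t : ℝ) * (U.card + V.card - t) ≤ N ∨ (t : ℝ) * Nat.card H ≤ N := by
    exact_mod_cast h2
  have hNle : N ≤ t * m + ∑ a ∈ U, missCount C V a := by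
    have hsplit : N = ∑ x ∈ (U + V) \ C, min t (sumReps U V x) +
        ∑ x ∈ (U + V) ∩ C, min t (sumReps U V x) := by
      rw [hN, ← Finset.sum_union (Finset.disjoint_sdiff_inter _ _), Finset.sdiff_union_inter]
    have hin : ∑ x ∈ (U + V) ∩ C, min t (sumReps U V x) ≤ t * m := by
      calc _ ≤ ∑ _x ∈ (U + V) ∩ C, t := Finset.sum_le_sum fun _ _ => min_le_left _ _
        _ = ((U + V) ∩ C).card * t := by simp
        _ ≤ m * t := Nat.mul_le_mul_right _
            ((Finset.card_le_card Finset.inter_subset_right).trans hC)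
        _ = t * m := mul_comm _ _
    have hout : ∑ x ∈ (U + V) \ C, min t (sumReps U V x) ≤ ∑ a ∈ U, missCount C V a :=
      (Finset.sum_le_sum fun _ _ => min_le_right _ _).trans (sum_sumReps_sdiff_le U V (U + V) C)
    omega
  have hsum : (∑ a ∈ U, (missCount C V a : ℝ)) ≤ t * (ε * m) := by
    calc (∑ a ∈ U, (missCount C V a : ℝ)) ≤ U.card • (ε ^ 2 * m / 2) :=
          Finset.sum_le_card_nsmul _ _ _ fun a ha => (hmiss a ha).le
      _ = U.card * (ε ^ 2 * m / 2) := nsmul_eq_mul _ _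
      _ ≤ (2 * m) * (ε ^ 2 * m / 2) := by
          have : (U.card : ℝ) ≤ 2 * m := by nlinarith [Nat.cast_nonneg (α := ℝ) m]
          gcongr
      _ = (ε * m) * (ε * m) := by ring
      _ ≤ t * (ε * m) := mul_le_mul_of_nonneg_right ht1 (by linarith)
  have hNle' : (N : ℝ) ≤ t * (m + ε * m) := by
    have : (N : ℝ) ≤ t * m + ∑ a ∈ U, (missCount C V a : ℝ) := by exact_mod_cast hNle
    linarith
  -- Either there is no defect, or `|H| ≤ N / t ≤ m + εm`, which makes `H` admissible for `β`, and
  -- the defect bound applies.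
  rcases h2' with h2' | h2'
  · have := le_of_mul_le_mul_left (h2'.trans hNle') ht0'
    linarith
  · have h3 := le_of_mul_le_mul_left (h2'.trans hNle') ht0'
    have h4 : (Nat.card H : ℝ) ≤ β := by exact_mod_cast card_le_maxSubgroupSize H hHf h3
    have h5 := le_of_mul_le_mul_left (h1'.trans hNle') ht0'
    linarith

set_option maxHeartbeats 1000000 in
-- With `q = √m / ε^2`, the initial family, the per-round fingerprints and the absorbing sets each
-- cost `n^(O(q))`, and `n^q = 2^(εm)`. Terminal containers contribute `2^(m + β + 4εm)`.
theorem card_largeSumsetPairs_le_of_sq_lt {n m s : ℕ} (hm : 1 ≤ m) (hmn : 16 * m ≤ n)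
    {Y : Finset G} (hY : Y.card = n) (hs : √(m : ℝ) ≤ s) (hmL : Real.logb 2 n ^ 2 < (m : ℝ)) :
    ((largeSumsetPairs Y m s).card : ℝ) ≤
      (2 : ℝ) ^ ((1 + 2 ^ 13 * alphaParam n m ^ (-(2 / 3) : ℝ)) *
        ((m : ℝ) + (maxSubgroupSize G
          ((m : ℝ) + alphaParam n m ^ (-(2 / 3) : ℝ) * (m : ℝ)) : ℝ))) := by
  have hL := four_le_logb hm hmn
  set L := Real.logb 2 n with hLdef
  have hL0 : 0 < L := by linarith
  have hm' : (1 : ℝ) ≤ m := by exact_mod_cast hm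
  have hn16 : (16 : ℝ) ≤ n := by
    have : 16 ≤ n := by omega
    exact_mod_cast this
  have hn0 : (0 : ℝ) < n := by linarith
  have hs1 : 1 ≤ √(m : ℝ) := Real.one_le_sqrt.2 hm'
  have hsq : √(m : ℝ) * √m = m := Real.mul_self_sqrt (by positivity)
  have hLs : L ≤ √(m : ℝ) := Real.le_sqrt_of_sq_le hmL.le
  set ε := alphaParam n m ^ (-(2 / 3) : ℝ) with hε
  have hx0 : 0 < √(m : ℝ) / L := by positivity
  have hε0 : 0 < ε := Real.rpow_pos_of_pos (Real.rpow_pos_of_pos hx0 _) _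
  have hε3 : ε ^ 3 * √(m : ℝ) = L := by
    rw [hε, alphaParam, ← Real.rpow_mul hx0.le, ← Real.rpow_natCast, ← Real.rpow_mul hx0.le,
      show (1 / 2 * -(2 / 3) * ((3 : ℕ) : ℝ) : ℝ) = -1 by norm_num, Real.rpow_neg_one, inv_div,
      div_mul_cancel₀ _ (by positivity)]
  have hε1 : ε ≤ 1 := by
    by_contra! h
    have : 1 < ε ^ 3 := one_lt_pow₀ h (by norm_num)
    nlinarith
  have hε3m : √(m : ℝ) * L = ε ^ 3 * m := by
    calc √(m : ℝ) * L = √m * (ε ^ 3 * √m) := by rw [hε3]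
      _ = ε ^ 3 * (√m * √m) := by ring
      _ = ε ^ 3 * m := by rw [hsq]
  have hεm : 1 ≤ ε * m := by
    have h1 : ε ^ 3 ≤ ε := pow_le_of_le_one hε0.le hε1 (by norm_num)
    have h2 : (1 : ℝ) ≤ √m * L := by nlinarith
    nlinarith
  set β := maxSubgroupSize G ((m : ℝ) + ε * m) with hβ
  -- `δ = 1/(1 + ε)` makes the initial containers have size at most `(1 + ε)m`.
  have hδ1 : (1 + ε)⁻¹ < 1 := inv_lt_one_of_one_lt₀ (by linarith)
  obtain ⟨𝓕, h𝓕1, h𝓕2, h𝓕3⟩ := exists_sqrt_container_family Y hδ1 hm (by omega)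
  set k := ⌈√(m : ℝ)⌉₊ with hk
  have hsk : √(m : ℝ) ≤ k := Nat.le_ceil _
  have hks : (k : ℝ) < √m + 1 := Nat.ceil_lt_add_one (by positivity)
  have hk1 : 1 ≤ k := Nat.ceil_pos.2 (by linarith)
  have hk0 : (0 : ℝ) < k := by linarith
  set D := ε ^ 2 * m / 2 with hD
  have hD0 : 0 < D := by positivity
  set M := (2 : ℝ) ^ ((m : ℝ) + β + 4 * (ε * m)) with hM
  have hM0 : 0 < M := by positivity
  -- The initial potential is at most `3m`, since `|X| ≤ 2m` and `C = ∅`, and every round lowers it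
  -- by `D / 2 = ε^2 m / 4`.
  set j := ⌈12 / ε ^ 2⌉₊ with hj
  have hj1 : 12 / ε ^ 2 ≤ j := Nat.le_ceil _
  have hj2 : (j : ℝ) < 12 / ε ^ 2 + 1 := Nat.ceil_lt_add_one (by positivity)
  have hinv : 1 ≤ 1 / ε ^ 2 := by
    rw [one_le_div (by positivity)]
    exact pow_le_one₀ hε0.le hε1
  set q := √(m : ℝ) / ε ^ 2 with hq
  have hqinv : q = √m * (1 / ε ^ 2) := by rw [hq]; ring
  have hq0 : 0 < q := by positivity
  have hX : ∀ X ∈ 𝓕, (((largeSumsetPairs Y m s).filter fun p =>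
      p.1 ⊆ X.1 ∧ p.2 ⊆ X.2).card : ℝ) ≤ (n : ℝ) ^ (50 * q) * M := by
    intro X hX
    obtain ⟨⟨hX1, hX2⟩, hc1, hc2⟩ := h𝓕2 X hX
    rw [← div_eq_mul_inv, div_le_iff₀ (by linarith), mul_comm] at hc1 hc2
    have hc2' : X.2.card ≤ 2 * m := by
      have : (X.2.card : ℝ) ≤ 2 * m := by nlinarith
      exact_mod_cast this
    have h := card_pairs_le_of_terminal (Y := Y) (XA := X.1) (XB := X.2) (m := m) (k := k)
      (D := D) (M := M) (by omega) hm hk1 hD0 hX1 hX2 hc2' hM0.le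
      (fun X₁ hX₁ X₂ hX₂ C hC hmiss => by
        have h1 : (X₁.card : ℝ) ≤ (1 + ε) * m :=
          le_trans (by exact_mod_cast Finset.card_le_card hX₁) hc1
        have h2 : (X₂.card : ℝ) ≤ (1 + ε) * m :=
          le_trans (by exact_mod_cast Finset.card_le_card hX₂) hc2
        have h3 := card_add_card_le hε0 hεm h1 h2 hε1 hC hmiss
        rw [← Real.rpow_natCast, hM]
        apply Real.rpow_le_rpow_of_exponent_le (by norm_num)
        push_cast
        exact h3)
      j ((largeSumsetPairs Y m s).filter fun p => p.1 ⊆ X.1 ∧ p.2 ⊆ X.2) X.2 ∅ le_rfl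
      (fun p hp => by
        obtain ⟨hp1, hp2, hp3⟩ := Finset.mem_filter.1 hp
        exact ⟨hp2, hp3, Finset.empty_subset _, (largeSumsetPairs_spec hs p hp1).2.2.2.2⟩)
      (by
        simp only [Finset.card_empty, Nat.cast_zero, sub_zero]
        have h1 : (X.2.card : ℝ) ≤ 2 * m := by exact_mod_cast hc2'
        have h2 : 12 / ε ^ 2 * (D / 2) = 3 * m := by rw [hD]; field_simp; ring
        have h3 : 12 / ε ^ 2 * (D / 2) ≤ j * (D / 2) :=
          mul_le_mul_of_nonneg_right hj1 (by linarith)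
        linarith)
    refine h.trans (mul_le_mul_of_nonneg_right ?_ hM0.le)
    rw [hY, Finset.card_empty, Nat.cast_zero, sub_zero]
    have e1 : (6 * (n : ℝ) ^ k) ^ (j + 1) ≤ (n : ℝ) ^ (42 * q) := by
      calc (6 * (n : ℝ) ^ k) ^ (j + 1) ≤ ((n : ℝ) ^ (k + 1)) ^ (j + 1) := by
            rw [pow_succ (n : ℝ) k, mul_comm]
            gcongr
            linarith
        _ = (n : ℝ) ^ (((k + 1) * (j + 1) : ℕ) : ℝ) := by
            rw [Real.rpow_natCast, pow_mul]
        _ ≤ _ := by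
            apply Real.rpow_le_rpow_of_exponent_le (by linarith)
            push_cast
            calc ((k : ℝ) + 1) * (j + 1) ≤ (3 * √m) * (14 * (1 / ε ^ 2)) := by
                  have a1 : (k : ℝ) + 1 ≤ 3 * √m := by linarith
                  have a2 : (j : ℝ) + 1 ≤ 14 * (1 / ε ^ 2) := by
                    have : 12 / ε ^ 2 = 12 * (1 / ε ^ 2) := by ring
                    linarith
                  exact mul_le_mul a1 a2 (by positivity) (by positivity)
              _ = 42 * q := by rw [hqinv]; ring
    have e2 : (n : ℝ) ^ ((m : ℝ) / (k * D / (4 * m))) ≤ (n : ℝ) ^ (8 * q) := by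
      apply Real.rpow_le_rpow_of_exponent_le (by linarith)
      rw [hD, hq, div_le_iff₀ (by positivity)]
      have : 8 * (√(m : ℝ) / ε ^ 2) * (k * (ε ^ 2 * m / 2) / (4 * m)) = √m * k := by
        field_simp; ring
      rw [this]
      nlinarith
    calc _ ≤ (n : ℝ) ^ (42 * q) * (n : ℝ) ^ (8 * q) := by gcongr
      _ = _ := by rw [← Real.rpow_add hn0]; congr 1; ring
  have hfam : (𝓕.card : ℝ) ≤ (n : ℝ) ^ (8 * q) := by
    rw [hY] at h𝓕1
    refine h𝓕1.trans (Real.rpow_le_rpow_of_exponent_le (by linarith) ?_)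
    have a1 : 2 * (√(m : ℝ) - 1) / (1 - (1 + ε)⁻¹) = 2 * (√m - 1) * (1 + ε) / ε := by
      have : 1 - (1 + ε)⁻¹ = ε / (1 + ε) := by field_simp; ring
      rw [this]; field_simp
    have a2 : 2 * (√(m : ℝ) - 1) * (1 + ε) / ε ≤ 4 * q := by
      rw [hq, div_le_iff₀ hε0]
      have : 4 * (√(m : ℝ) / ε ^ 2) * ε = 4 * √m / ε := by field_simp
      rw [this, le_div_iff₀ hε0]
      have h1 : (√(m : ℝ) - 1) * (1 + ε) ≤ √m * 2 :=
        mul_le_mul (by linarith) (by linarith) (by linarith) (by linarith)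
      have h2 : 2 * (√(m : ℝ) - 1) * (1 + ε) * ε ≤ 2 * (√(m : ℝ) - 1) * (1 + ε) * 1 :=
        mul_le_mul_of_nonneg_left hε1 (mul_nonneg (by linarith) (by linarith))
      linarith
    have a3 : √(m : ℝ) ≤ q := by
      rw [hqinv]; nlinarith
    linarith
  have hcov := card_le_card_mul_of_cover (P := largeSumsetPairs Y m s) (𝓕 := 𝓕)
    (fun p hp => by
      obtain ⟨a, b, c, d, e⟩ := largeSumsetPairs_spec hs p hp
      exact h𝓕3 _ _ a b c d e) hX
  refine hcov.trans ?_
  calc (𝓕.card : ℝ) * ((n : ℝ) ^ (50 * q) * M) ≤ (n : ℝ) ^ (8 * q) * ((n : ℝ) ^ (50 * q) * M) := by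
        gcongr
    _ = (n : ℝ) ^ (58 * q) * M := by
        rw [← mul_assoc, ← Real.rpow_add hn0]; congr 2; ring
    _ = (2 : ℝ) ^ (58 * (ε * m) + ((m : ℝ) + β + 4 * (ε * m))) := by
        rw [rpow_eq_two_rpow hn0, hM, ← Real.rpow_add (by norm_num)]
        congr 2
        calc L * (58 * q) = 58 * (√m * L) / ε ^ 2 := by rw [hq]; ring
          _ = 58 * (ε * m) := by rw [hε3m]; field_simp
    -- The excess over `m + β` is `62εm`, well within `2^13 * ε * (m + β)`.
    _ ≤ _ := by
        apply Real.rpow_le_rpow_of_exponent_le (by norm_num)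
        have : (0 : ℝ) ≤ ε * β := by positivity
        nlinarith

end Terminal

theorem theorem1p7 {G : Type*} [AddCommGroup G] [DecidableEq G] (n m : ℕ) (hm : 1 ≤ m)
    (hmn : 16 * m ≤ n) (Y : Finset G) (hY : Y.card = n) :
    ((nonemptySumsetPairs Y m).card : ℝ) ≤
        (n : ℝ) ^ (6 * Real.sqrt m) * (∑ k ∈ Finset.range (m + 1), (n.choose k : ℝ)) ∧
      ∀ s : ℕ, Real.sqrt m ≤ (s : ℝ) →
        ((m : ℝ) ≤ (Real.logb 2 n) ^ 2 →
          ((largeSumsetPairs Y m s).card : ℝ) ≤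
            (n : ℝ) ^ ((4 + 6 * alphaParam n m) * Real.sqrt m)) ∧
        ((Real.logb 2 n) ^ 2 < (m : ℝ) →
          ((largeSumsetPairs Y m s).card : ℝ) ≤
            (2 : ℝ) ^ ((1 + 2 ^ 13 * alphaParam n m ^ (-(2 / 3) : ℝ)) *
              ((m : ℝ) + (maxSubgroupSize G
                ((m : ℝ) + alphaParam n m ^ (-(2 / 3) : ℝ) * (m : ℝ)) : ℝ)))) :=
  ⟨card_nonemptySumsetPairs_le hm hmn hY, fun _ hs =>
    ⟨card_largeSumsetPairs_le_of_le_sq hm hmn hY hs,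
      card_largeSumsetPairs_le_of_sq_lt hm hmn hY hs⟩⟩
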